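/- Use the Euclidean norm on $\mathbb R^m$ and the spectral norm for matrices. Consider the impulsive system $$x' = Ax + f(t,x) + g(t),\quad t\neq\theta_k,\qquad \Delta x|_{t=\theta_k} = Bx(\theta_k) + h(x(\theta_k)),\qquad (1)$$ where $\Delta x|_{t=\theta_k}=x(\theta_k+)-x(\theta_k)$ and solutions are left-continuous at the $\theta_k$. Here $A,B\in\mathbb R^{m\times m}$; $f:\mathbb R\times\mathbb R^m\to\mathbb R^m$ and $h:\mathbb R^m\to\mathbb R^m$ are continuous; $f(t+\omega,x)=f(t,x)$ for some $\omega>0$; $(\theta_k)_{k\in\mathbb Z}$ is strictly increasing with $\theta_{k+p}=\theta_k+\omega$ for all $k$, for some $p\in\mathbb N$; and $g(t)=\sigma_k$ for $t\in(\theta_{kp},\theta_{(k+1)p}]$, $k\in\mathbb Z$, where $(\sigma_k)_{k\in\mathbb Z}$ is a bounded sequence in $\mathbb R^m$. For $t\ge s$ let $U(t,s)=e^{A(t-s)}(I+B)^{i([s,t))}$, where $i(J)$ is the number of the $\theta_k$ lying in $J$ (the matriciant of $x'=Ax$, $\Delta x|_{t=\theta_k}=Bx(\theta_k)$, when $AB=BA$).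 Assume: - (A1) $AB=BA$ and $\det(I+B)\ne0$; - (A2) all eigenvalues of $A+\frac p\omega\log(I+B)$ (principal logarithm) have negative real parts; - (A3) $\|f(t,x)\|\le M_f$ and $\|h(x)\|\le M_h$ for all $t,x$, for some $M_f,M_h>0$; - (A4) $\|f(t,x_1)-f(t,x_2)\|\le L_f\|x_1-x_2\|$ and $\|h(x_1)-h(x_2)\|\le L_h\|x_1-x_2\|$ for all $t,x_1,x_2$, for some $L_f,L_h>0$; and, for some $N,\lambda>0$ with $\|U(t,s)\|\le Ne^{-\lambda(t-s)}$ for all $t\ge s$, - (A5) $N\left(\frac{L_f}{\lambda}+\frac{pL_h}{1-e^{-\lambda\omega}}\right)<1$; - (A6) $NL_f+\frac p\omega\ln(1+NL_h)<\lambda$; - (A7) $L_h\|(I+B)^{-1}\|<1$. A bounded sequence $(\sigma_k)_{k\in\mathbb Z}$ is *unpredictable with shifts* $(\zeta_n)_{n\in\mathbb N}$, a sequence of positive integers with $\zeta_n\to\infty$, if $\|\sigma_{k+\zeta_n}-\sigma_k\|\to0$ as $n\to\infty$ for each $k$ (equivalently, uniformly for $k$ in bounded intervals), and there are $\delta_0>0$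 and positive integers $\eta_n\to\infty$ with $\|\sigma_{\zeta_n+\eta_n}-\sigma_{\eta_n}\|\ge\delta_0$ for all $n$. It is *unpredictable* if this holds for some $(\zeta_n)$. A bounded function $\varphi:\mathbb R\to\mathbb R^m$ that is continuous off $\{\theta_k\}$, left-continuous at each $\theta_k$, and has right limits there is *unpredictable with shifts* $(\mu_n)_{n\in\mathbb N}$, a real sequence with $\mu_n\to\infty$, if there are $\epsilon_0,r>0$ and reals $\tau_n\to\infty$ such that: (i) for every $\epsilon>0$ there is $\delta>0$ such that $\|\varphi(s_1)-\varphi(s_2)\|<\epsilon$ whenever $s_1,s_2$ lie in the same interval $(\theta_k,\theta_{k+1}]$ and $|s_1-s_2|<\delta$; (ii) $\|\varphi(t+\mu_n)-\varphi(t)\|\to0$ as $n\to\infty$ uniformly on compact subsets of $\mathbb R$; (iii) $\|\varphi(t+\mu_n)-\varphi(t)\|\ge\epsilon_0$ for all $n$ and all $t\in[\tau_n-r,\tau_n+r]$. It is *unpredictable* if this holds for some $(\mu_n)$. **Theorem.** Under these assumptions, if $(\sigma_k)_{k\in\mathbb Z}$ is unpredictable, then (1) has exactly one unpredictable solution $\phi:\mathbb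 R\to\mathbb R^m$, and $\phi$ is asymptotically stable in the sense of Lyapunov (for every initial time $t_0$ it is stable, and it attracts all solutions on $[t_0,\infty)$ that start sufficiently close to it). Moreover, whenever $(\sigma_k)$ is unpredictable with shifts $(\zeta_n)$, $\phi$ is unpredictable with shifts $\mu_n=\omega\zeta_n$. -/

import Mathlib

open Filter Set
open scoped Topology Matrix.Norms.L2Operator

/-- `ℝ^m` with the Euclidean norm.  Matrices carry the spectral norm (the scoped `L2Operator` norm). -/
abbrev Vec (m : ℕ) : Type := EuclideanSpace ℝ (Fin m)

/-- The matrix-vector product `M v` in `ℝ^m`. -/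
noncomputable def mulE {m : ℕ} (M : Matrix (Fin m) (Fin m) ℝ) (v : Vec m) : Vec m :=
  Matrix.toEuclideanCLM (𝕜 := ℝ) M v

/-- Regular impulse moments: `θ` is strictly increasing and `θ_{k+p} = θ_k + ω` with `ω > 0`.
(This forces `p ≥ 1`.) -/
structure RegularMoments (θ : ℤ → ℝ) (p : ℕ) (ω : ℝ) : Prop where
  strictMono : StrictMono θ
  period_pos : 0 < ω
  shift : ∀ k : ℤ, θ (k + p) = θ k + ω

/-- `x` solves, on the interval `J`, the impulsive system
`x' = A x + f(t,x) + g(t)` for `t ≠ θ_k`,  `Δx|_{t = θ_k} = B x(θ_k) + h(x(θ_k))`,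
where `Δx|_{t = θ_k} = x(θ_k+) - x(θ_k)` and solutions are left-continuous at the `θ_k`.
It is used with `J = ℝ` and with `J = [t₀, ∞)`; derivatives and limits are taken inside `J`. -/
structure IsSolutionOn {m : ℕ} (A B : Matrix (Fin m) (Fin m) ℝ)
    (f : ℝ → Vec m → Vec m) (g : ℝ → Vec m) (h : Vec m → Vec m) (θ : ℤ → ℝ)
    (J : Set ℝ) (x : ℝ → Vec m) : Prop where
  deriv : ∀ t ∈ J, t ∉ range θ →
    HasDerivWithinAt x (mulE A (x t) + f t (x t) + g t) J t
  left_cont : ∀ k : ℤ, θ k ∈ J → ContinuousWithinAt x (J ∩ Iic (θ k)) (θ k)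
  jump : ∀ k : ℤ, θ k ∈ J →
    Tendsto x (𝓝[J ∩ Ioi (θ k)] (θ k)) (𝓝 (x (θ k) + (mulE B (x (θ k)) + h (x (θ k)))))

/-- The number `i(J)` of terms of the sequence `θ` (a strictly increasing one) lying in `J`. -/
noncomputable def countMoments (θ : ℤ → ℝ) (J : Set ℝ) : ℕ := {k : ℤ | θ k ∈ J}.ncard

/-- The matriciant `U(t,s) = e^{A(t-s)} (I+B)^{i([s,t))}`, `t ≥ s`, of the linear homogeneous system
`x' = A x` for `t ≠ θ_k`, `Δx|_{t = θ_k} = B x(θ_k)`, for commuting `A` and `B`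
(see `matriciant_self` and `matriciant_isSolution`). -/
noncomputable def matriciant {m : ℕ} (A B : Matrix (Fin m) (Fin m) ℝ) (θ : ℤ → ℝ) (t s : ℝ) :
    Matrix (Fin m) (Fin m) ℝ :=
  NormedSpace.exp ((t - s) • A) * (1 + B) ^ countMoments θ (Ico s t)

theorem matriciant_self {m : ℕ} (A B : Matrix (Fin m) (Fin m) ℝ) (θ : ℤ → ℝ) (s : ℝ) :
    matriciant A B θ s s = 1 := by
  simp [matriciant, countMoments]

theorem RegularMoments.shift_mul {θ : ℤ → ℝ} {p : ℕ} {ω : ℝ} (hθ : RegularMoments θ p ω)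
    (n : ℕ) (k : ℤ) : θ (k + n * p) = θ k + n * ω := by
  induction n with
  | zero => simp
  | succ n ih =>
    have e : k + ((n + 1 : ℕ) : ℤ) * p = (k + n * p) + p := by push_cast; ring
    rw [e, hθ.shift, ih]; push_cast; ring

theorem RegularMoments.exists_lt {θ : ℤ → ℝ} {p : ℕ} {ω : ℝ} (hθ : RegularMoments θ p ω)
    (t : ℝ) : ∃ k : ℤ, θ k < t := by
  obtain ⟨n, hn⟩ := exists_nat_gt ((θ 0 - t) / ω)
  refine ⟨-(n * p), ?_⟩
  have h1 := hθ.shift_mul n (-(n * p))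
  rw [neg_add_cancel] at h1
  rw [div_lt_iff₀ hθ.period_pos] at hn
  linarith

theorem RegularMoments.exists_ge {θ : ℤ → ℝ} {p : ℕ} {ω : ℝ} (hθ : RegularMoments θ p ω)
    (t : ℝ) : ∃ k : ℤ, t ≤ θ k := by
  obtain ⟨n, hn⟩ := exists_nat_gt ((t - θ 0) / ω)
  refine ⟨0 + n * p, ?_⟩
  rw [hθ.shift_mul n 0]
  rw [div_lt_iff₀ hθ.period_pos] at hn
  linarith

/-- The intervals `(θ_k, θ_{k+1}]` cover the real line. -/
theorem RegularMoments.exists_mem_Ioc {θ : ℤ → ℝ} {p : ℕ} {ω : ℝ} (hθ : RegularMoments θ p ω)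
    (t : ℝ) : ∃ k : ℤ, t ∈ Ioc (θ k) (θ (k + 1)) := by
  obtain ⟨a, ha⟩ := hθ.exists_lt t
  obtain ⟨b, hb⟩ := hθ.exists_ge t
  obtain ⟨k, hk, hmax⟩ := Int.exists_greatest_of_bdd (P := fun k => θ k < t)
    ⟨b, fun z hz => (hθ.strictMono.lt_iff_lt.1 (lt_of_lt_of_le hz hb)).le⟩ ⟨a, ha⟩
  refine ⟨k, hk, ?_⟩
  by_contra hc
  have := hmax (k + 1) (not_le.1 hc)
  omega

theorem countMoments_of_mem_Ioc {θ : ℤ → ℝ} (hθ : StrictMono θ) {s t : ℝ} {k : ℤ}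
    (ht : t ∈ Ioc (θ k) (θ (k + 1))) :
    countMoments θ (Ico s t) = {j : ℤ | s ≤ θ j ∧ j ≤ k}.ncard := by
  unfold countMoments
  congr 1
  ext j
  simp only [mem_ofPred_eq, mem_Ico]
  refine and_congr_right fun _ => ⟨fun h => ?_, fun h => ?_⟩
  · have := hθ.lt_iff_lt.1 (lt_of_lt_of_le h ht.2)
    omega
  · exact lt_of_le_of_lt (hθ.monotone h) ht.1

theorem countMoments_after {θ : ℤ → ℝ} {p : ℕ} {ω : ℝ} (hθ : RegularMoments θ p ω)
    {s t : ℝ} {k : ℤ} (hs : s ≤ θ k) (ht : t ∈ Ioc (θ k) (θ (k + 1))) :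
    countMoments θ (Ico s t) = countMoments θ (Ico s (θ k)) + 1 := by
  have hk : θ k ∈ Ioc (θ (k - 1)) (θ (k - 1 + 1)) :=
    ⟨hθ.strictMono (by omega), by simp⟩
  rw [countMoments_of_mem_Ioc hθ.strictMono ht, countMoments_of_mem_Ioc hθ.strictMono hk]
  obtain ⟨a, ha⟩ := hθ.exists_lt s
  have hfin : {j : ℤ | s ≤ θ j ∧ j ≤ k - 1}.Finite :=
    (finite_Icc a k).subset fun j hj => ⟨(hθ.strictMono.lt_iff_lt.1 (lt_of_lt_of_le ha hj.1)).le,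
      by have := hj.2; omega⟩
  rw [← ncard_insert_of_notMem (a := k) (by simp) hfin]
  congr 1
  ext j
  simp only [mem_ofPred_eq, mem_insert_iff]
  constructor
  · rintro ⟨h1, h2⟩
    rcases eq_or_lt_of_le h2 with h | h
    · exact Or.inl h
    · exact Or.inr ⟨h1, by omega⟩
  · rintro (rfl | ⟨h1, h2⟩)
    · exact ⟨hs, le_rfl⟩
    · exact ⟨h1, by omega⟩

theorem hasDerivAt_exp_mulE {m : ℕ} (A M : Matrix (Fin m) (Fin m) ℝ) (s t : ℝ) (v : Vec m) :
    HasDerivAt (fun t => mulE (NormedSpace.exp ((t - s) • A) * M) v)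
      (mulE A (mulE (NormedSpace.exp ((t - s) • A) * M) v)) t := by
  have h1 : HasDerivAt (fun u : ℝ => NormedSpace.exp (u • A))
      (A * NormedSpace.exp ((t - s) • A)) (t - s) :=
    hasDerivAt_exp_smul_const' A (t - s)
  have h2 := (h1.comp_sub_const t s).mul_const M
  have h3 : HasDerivAt (fun t => Matrix.toEuclideanCLM (𝕜 := ℝ) (NormedSpace.exp ((t - s) • A) * M))
      (Matrix.toEuclideanCLM (𝕜 := ℝ) (A * NormedSpace.exp ((t - s) • A) * M)) t := by
    let L : Matrix (Fin m) (Fin m) ℝ →L[ℝ] (Vec m →L[ℝ] Vec m) :=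
      LinearMap.toContinuousLinearMap
        (Matrix.toEuclideanCLM (n := Fin m) (𝕜 := ℝ)).toAlgEquiv.toLinearMap
    exact L.hasFDerivAt.comp_hasDerivAt t h2
  have h4 := h3.clm_apply (hasDerivAt_const t v)
  simpa [mulE, mul_assoc] using h4

/-- For commuting `A` and `B`, the columns of `U(·,s)` solve the linear homogeneous system
on `[s, ∞)`. -/
theorem matriciant_isSolution {m : ℕ} {A B : Matrix (Fin m) (Fin m) ℝ} {θ : ℤ → ℝ} {p : ℕ} {ω : ℝ}
    (hθ : RegularMoments θ p ω) (hAB : Commute A B) (s : ℝ) (v : Vec m) :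
    IsSolutionOn A B (fun _ _ => 0) (fun _ => 0) (fun _ => 0) θ (Ici s)
      (fun t => mulE (matriciant A B θ t s) v) := by
  have key : ∀ k : ℤ, ∃ n : ℕ, ∀ t ∈ Ioc (θ k) (θ (k + 1)),
      mulE (matriciant A B θ t s) v = mulE (NormedSpace.exp ((t - s) • A) * (1 + B) ^ n) v := by
    intro k
    refine ⟨{j : ℤ | s ≤ θ j ∧ j ≤ k}.ncard, fun t ht => ?_⟩
    unfold matriciant
    rw [countMoments_of_mem_Ioc hθ.strictMono ht]
  refine ⟨fun t _ hr => ?_, fun k _ => ?_, fun k hk => ?_⟩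
  · obtain ⟨k, hk⟩ := hθ.exists_mem_Ioc t
    obtain ⟨n, hn⟩ := key k
    have hlt : t < θ (k + 1) := lt_of_le_of_ne hk.2 fun h => hr ⟨_, h.symm⟩
    have hev : (fun t => mulE (matriciant A B θ t s) v) =ᶠ[𝓝 t]
        fun t => mulE (NormedSpace.exp ((t - s) • A) * (1 + B) ^ n) v := by
      filter_upwards [Ioo_mem_nhds hk.1 hlt] with u hu using hn u ⟨hu.1, hu.2.le⟩
    have := (hasDerivAt_exp_mulE A ((1 + B) ^ n) s t v).congr_of_eventuallyEq hev
    simp only [add_zero]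
    rw [hn t hk]
    exact this.hasDerivWithinAt
  · obtain ⟨n, hn⟩ := key (k - 1)
    rw [sub_add_cancel] at hn
    have hlt : θ (k - 1) < θ k := hθ.strictMono (by omega)
    have hc := (hasDerivAt_exp_mulE A ((1 + B) ^ n) s (θ k) v).continuousAt.continuousWithinAt
      (s := Ici s ∩ Iic (θ k))
    refine hc.congr_of_eventuallyEq ?_ (hn _ ⟨hlt, le_rfl⟩)
    filter_upwards [self_mem_nhdsWithin, mem_nhdsWithin_of_mem_nhds (Ioi_mem_nhds hlt)] with u hu hu'
    exact hn u ⟨hu', hu.2⟩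
  · have hlt : θ k < θ (k + 1) := hθ.strictMono (by omega)
    set n := countMoments θ (Ico s (θ k)) with hn
    have hc := (hasDerivAt_exp_mulE A ((1 + B) ^ (n + 1)) s (θ k) v).continuousAt.continuousWithinAt
      (s := Ici s ∩ Ioi (θ k))
    have hcomm : Commute (NormedSpace.exp ((θ k - s) • A)) B :=
      (hAB.smul_left _).exp_left
    have hval : mulE (matriciant A B θ (θ k) s) v + (mulE B (mulE (matriciant A B θ (θ k) s) v) + 0)
        = mulE (NormedSpace.exp ((θ k - s) • A) * (1 + B) ^ (n + 1)) v := by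
      have : NormedSpace.exp ((θ k - s) • A) * (1 + B) ^ (n + 1)
          = (1 + B) * (NormedSpace.exp ((θ k - s) • A) * (1 + B) ^ n) := by
        rw [pow_succ', ← mul_assoc, ← mul_assoc,
          ((Commute.one_right _).add_right hcomm).eq]
      rw [this]
      simp [mulE, matriciant, ← hn, add_mul]
    rw [hval]
    refine Tendsto.congr' ?_ hc
    filter_upwards [self_mem_nhdsWithin, mem_nhdsWithin_of_mem_nhds (Iio_mem_nhds hlt)] with u hu hu'
    simp only [matriciant]
    rw [countMoments_after hθ hk ⟨hu.2, (mem_Iio.1 hu').le⟩]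

/-- `X` is the principal logarithm of the complex matrix `M`: the (unique) logarithm all of whose
eigenvalues have imaginary part in `(-π, π]`; it exists exactly for invertible `M`. -/
def IsPrincipalLog {m : ℕ} (M X : Matrix (Fin m) (Fin m) ℂ) : Prop :=
  NormedSpace.exp X = M ∧ ∀ z ∈ spectrum ℂ X, z.im ∈ Ioc (-Real.pi) Real.pi

/-- A real matrix regarded as a complex one. -/
def toComplex {m : ℕ} (M : Matrix (Fin m) (Fin m) ℝ) : Matrix (Fin m) (Fin m) ℂ :=
  M.map (fun a : ℝ => (a : ℂ))

/-- All eigenvalues of `A + c log(I + B)` have negative real parts. -/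
def StableLog {m : ℕ} (A B : Matrix (Fin m) (Fin m) ℝ) (c : ℝ) : Prop :=
  ∃ X : Matrix (Fin m) (Fin m) ℂ, IsPrincipalLog (1 + toComplex B) X ∧
    ∀ z ∈ spectrum ℂ (toComplex A + (c : ℂ) • X), z.re < 0

/-- The bounded sequence `σ` is unpredictable with the sequence of shifts `ζ`. -/
structure UnpredictableSeqWith {m : ℕ} (σ : ℤ → Vec m) (ζ : ℕ → ℕ) : Prop where
  bounded : ∃ M : ℝ, ∀ k, ‖σ k‖ ≤ M
  shift_pos : ∀ n, 0 < ζ n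
  shift_tendsto : Tendsto ζ atTop atTop
  recurrent : ∀ k : ℤ, Tendsto (fun n => ‖σ (k + ζ n) - σ k‖) atTop (𝓝 0)
  separated : ∃ δ₀ > (0 : ℝ), ∃ η : ℕ → ℕ, (∀ n, 0 < η n) ∧ Tendsto η atTop atTop ∧
    ∀ n, δ₀ ≤ ‖σ (ζ n + η n) - σ (η n)‖

/-- Unpredictable sequences indexed by `ℤ`. -/
def UnpredictableSeq {m : ℕ} (σ : ℤ → Vec m) : Prop := ∃ ζ : ℕ → ℕ, UnpredictableSeqWith σ ζ

/-- The bounded, piecewise continuous function `φ` with possible discontinuities (of the first kind,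
with left continuity) at the moments `θ_k` is unpredictable with the sequence of shifts `μ`. -/
structure UnpredictableFunWith {m : ℕ} (θ : ℤ → ℝ) (φ : ℝ → Vec m) (μ : ℕ → ℝ) : Prop where
  bounded : ∃ M : ℝ, ∀ t, ‖φ t‖ ≤ M
  cont : ∀ t, t ∉ range θ → ContinuousAt φ t
  left_limit : ∀ k : ℤ, Tendsto φ (𝓝[<] (θ k)) (𝓝 (φ (θ k)))
  right_limit : ∀ k : ℤ, ∃ v : Vec m, Tendsto φ (𝓝[>] (θ k)) (𝓝 v)
  unif_cont : ∀ ε > (0 : ℝ), ∃ δ > (0 : ℝ), ∀ k : ℤ,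
    ∀ s₁ ∈ Ioc (θ k) (θ (k + 1)), ∀ s₂ ∈ Ioc (θ k) (θ (k + 1)),
      |s₁ - s₂| < δ → ‖φ s₁ - φ s₂‖ < ε
  shift_tendsto : Tendsto μ atTop atTop
  recurrent : ∀ K : Set ℝ, IsCompact K →
    TendstoUniformlyOn (fun n t => φ (t + μ n)) φ atTop K
  separated : ∃ ε₀ > (0 : ℝ), ∃ r > (0 : ℝ), ∃ τ : ℕ → ℝ, Tendsto τ atTop atTop ∧
    ∀ n, ∀ t ∈ Icc (τ n - r) (τ n + r), ε₀ ≤ ‖φ (t + μ n) - φ t‖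

/-- Unpredictable piecewise continuous functions with (regular) possible discontinuity moments `θ`. -/
def UnpredictableFun {m : ℕ} (θ : ℤ → ℝ) (φ : ℝ → Vec m) : Prop :=
  ∃ μ : ℕ → ℝ, UnpredictableFunWith θ φ μ

/-- Lyapunov asymptotic stability of the solution `φ` of the impulsive system: for every initial
time, `φ` is stable and attracts all solutions starting close enough to it. -/
def AsymptoticallyStable {m : ℕ} (A B : Matrix (Fin m) (Fin m) ℝ)
    (f : ℝ → Vec m → Vec m) (g : ℝ → Vec m) (h : Vec m → Vec m) (θ : ℤ → ℝ)
    (φ : ℝ → Vec m) : Prop :=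
  ∀ t₀ : ℝ,
    (∀ ε > (0 : ℝ), ∃ δ > (0 : ℝ), ∀ x : ℝ → Vec m, IsSolutionOn A B f g h θ (Ici t₀) x →
      ‖x t₀ - φ t₀‖ < δ → ∀ t ≥ t₀, ‖x t - φ t‖ < ε) ∧
    (∃ δ > (0 : ℝ), ∀ x : ℝ → Vec m, IsSolutionOn A B f g h θ (Ici t₀) x →
      ‖x t₀ - φ t₀‖ < δ → Tendsto (fun t => ‖x t - φ t‖) atTop (𝓝 0))

/-! # Unpredictable solutions of impulsive systems with unpredictable perturbations

All four assertions follow from one estimate (`HasExponentialEstimate`): if `w` solves the linear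
impulsive system with forcing bounded by `L_f‖w‖ + ε` between the impulses and by `L_h‖w‖ + ε` at
them, then `‖w(t)‖ ≤ C (‖w(a)‖ e^{-γ(t-a)} + ε)`.  It is applied to differences of solutions.

The estimate (`exists_exponential_estimate`) rests on a comparison principle.  Along the curve
`r ↦ U(b, r) w(r)` the linear part of the equation drops out, so the bound `‖U(b, r)‖ ≤ N e^{-λ(b-r)}`
shows that `‖w‖` stays below every scalar function `ρ` with `ρ(a) ≥ N‖w(a)‖`, `ρ' + λρ ≥ N‖F‖`
between the impulses and `Δρ ≥ N‖H_k‖` at them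
(`IsForcedSolutionOn.norm_le_of_supersolution`).  The strict inequality
`N L_f + (p/ω) ln(1 + N L_h) < λ` leaves room for an explicit decaying `ρ` and for absorbing the
Lipschitz terms by a geometric iteration.

*Existence.* The solutions started at `θ_s` with the value `0` are uniformly bounded, and by the
estimate they form a Cauchy family as `s → -∞`; the limit is a bounded solution `φ` on the line
(`exists_bounded_solution`).

*Uniqueness and stability.* The difference of two solutions decays exponentially; starting from
`a → -∞`, two bounded solutions coincide (`HasExponentialEstimate.eq_of_bounded`).

*Unpredictability.* The shift `φ(· + ω ζ_n)` solves the system with the input `σ_{k+ζ_n}` in place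
of `σ_k`.  Where these inputs are close, so are the solutions (`tendstoUniformlyOn_shift`).  On the
period where they differ by at least `δ₀`, the difference of the solutions is driven by a constant
vector of that size and cannot remain small (`exists_separated_shift`); as `φ` is Lipschitz between
the impulses, it stays away from `0` on an interval of fixed length.
-/

/-! ### Matrices acting on Euclidean space -/

theorem norm_mulE_le {m : ℕ} (M : Matrix (Fin m) (Fin m) ℝ) (v : Vec m) :
    ‖mulE M v‖ ≤ ‖M‖ * ‖v‖ :=
  Matrix.l2_opNorm_mulVec M v

theorem mulE_mul {m : ℕ} (M M' : Matrix (Fin m) (Fin m) ℝ) (v : Vec m) :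
    mulE (M * M') v = mulE M (mulE M' v) := by
  simp [mulE]

theorem mulE_one {m : ℕ} (v : Vec m) : mulE (1 : Matrix (Fin m) (Fin m) ℝ) v = v := by
  simp [mulE]

theorem mulE_add {m : ℕ} (M : Matrix (Fin m) (Fin m) ℝ) (v v' : Vec m) :
    mulE M (v + v') = mulE M v + mulE M v' := by
  simp [mulE]

theorem mulE_sub {m : ℕ} (M : Matrix (Fin m) (Fin m) ℝ) (v v' : Vec m) :
    mulE M (v - v') = mulE M v - mulE M v' := by
  simp [mulE]

theorem add_mulE {m : ℕ} (M M' : Matrix (Fin m) (Fin m) ℝ) (v : Vec m) :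
    mulE (M + M') v = mulE M v + mulE M' v := by
  simp [mulE]

theorem neg_mulE {m : ℕ} (M : Matrix (Fin m) (Fin m) ℝ) (v : Vec m) :
    mulE (-M) v = -mulE M v := by
  simp [mulE]

theorem tendsto_clm_apply {E G : Type*} [NormedAddCommGroup E] [NormedSpace ℝ E]
    [NormedAddCommGroup G] [NormedSpace ℝ G] {α : Type*} {l : Filter α} {T : α → E →L[ℝ] G}
    {T₀ : E →L[ℝ] G} {v : α → E} {v₀ : E} (hT : Tendsto T l (𝓝 T₀)) (hv : Tendsto v l (𝓝 v₀)) :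
    Tendsto (fun r => T r (v r)) l (𝓝 (T₀ v₀)) :=
  (isBoundedBilinearMap_apply (𝕜 := ℝ) (E := E) (F := G)).continuous.tendsto (T₀, v₀) |>.comp
    (hT.prodMk_nhds hv)

theorem tendsto_mulE {m : ℕ} {α : Type*} {l : Filter α}
    {M : α → Matrix (Fin m) (Fin m) ℝ} {M₀ : Matrix (Fin m) (Fin m) ℝ} {v : α → Vec m} {v₀ : Vec m}
    (hM : Tendsto M l (𝓝 M₀)) (hv : Tendsto v l (𝓝 v₀)) :
    Tendsto (fun r => mulE (M r) (v r)) l (𝓝 (mulE M₀ v₀)) := by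
  let L : Matrix (Fin m) (Fin m) ℝ →L[ℝ] (Vec m →L[ℝ] Vec m) :=
    LinearMap.toContinuousLinearMap
      (Matrix.toEuclideanCLM (n := Fin m) (𝕜 := ℝ)).toAlgEquiv.toLinearMap
  have h1 : Tendsto (fun r => L (M r)) l (𝓝 (L M₀)) := (L.continuous.tendsto M₀).comp hM
  exact tendsto_clm_apply h1 hv

theorem HasDerivWithinAt.mulE {m : ℕ} {M : ℝ → Matrix (Fin m) (Fin m) ℝ}
    {M' : Matrix (Fin m) (Fin m) ℝ} {v : ℝ → Vec m} {v' : Vec m} {s : Set ℝ} {t : ℝ}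
    (hM : HasDerivWithinAt M M' s t) (hv : HasDerivWithinAt v v' s t) :
    HasDerivWithinAt (fun r => mulE (M r) (v r)) (mulE M' (v t) + mulE (M t) v') s t := by
  let L : Matrix (Fin m) (Fin m) ℝ →L[ℝ] (Vec m →L[ℝ] Vec m) :=
    LinearMap.toContinuousLinearMap
      (Matrix.toEuclideanCLM (n := Fin m) (𝕜 := ℝ)).toAlgEquiv.toLinearMap
  have h1 : HasDerivWithinAt (fun r => L (M r)) (L M') s t :=
    L.hasFDerivAt.comp_hasDerivWithinAt t hM
  exact h1.clm_apply hv

theorem hasDerivAt_exp_sub_smul {m : ℕ} (A : Matrix (Fin m) (Fin m) ℝ) (b t : ℝ) :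
    HasDerivAt (fun r : ℝ => NormedSpace.exp ((b - r) • A))
      (-(NormedSpace.exp ((b - t) • A) * A)) t := by
  have h1 : HasDerivAt (fun u : ℝ => NormedSpace.exp (u • A))
      (NormedSpace.exp ((b - t) • A) * A) (b - t) :=
    hasDerivAt_exp_smul_const A (b - t)
  exact h1.comp_const_sub b t

/-! ### Linear impulsive systems with forcing -/

/-- `w` solves on `J` the linear impulsive system with forcing `w' = A w + F(t)` for `t ≠ θ_k`,
`Δw = B w(θ_k) + H_k` at `t = θ_k`, with left continuity at the `θ_k`.  The difference of two
solutions of the nonlinear system is such a `w`, and this is how all solutions are compared. -/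
structure IsForcedSolutionOn {m : ℕ} (A B : Matrix (Fin m) (Fin m) ℝ) (θ : ℤ → ℝ)
    (F : ℝ → Vec m) (H : ℤ → Vec m) (J : Set ℝ) (w : ℝ → Vec m) : Prop where
  deriv : ∀ t ∈ J, t ∉ range θ → HasDerivWithinAt w (mulE A (w t) + F t) J t
  left_cont : ∀ k : ℤ, θ k ∈ J → ContinuousWithinAt w (J ∩ Iic (θ k)) (θ k)
  jump : ∀ k : ℤ, θ k ∈ J →
    Tendsto w (𝓝[J ∩ Ioi (θ k)] (θ k)) (𝓝 (w (θ k) + (mulE B (w (θ k)) + H k)))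

theorem IsForcedSolutionOn.mono {m : ℕ} {A B : Matrix (Fin m) (Fin m) ℝ} {θ : ℤ → ℝ}
    {F : ℝ → Vec m} {H : ℤ → Vec m} {J J' : Set ℝ} {w : ℝ → Vec m}
    (hw : IsForcedSolutionOn A B θ F H J w) (hJ : J' ⊆ J) :
    IsForcedSolutionOn A B θ F H J' w where
  deriv t ht hr := (hw.deriv t (hJ ht) hr).mono hJ
  left_cont k hk := (hw.left_cont k (hJ hk)).mono (inter_subset_inter_left _ hJ)
  jump k hk := (hw.jump k (hJ hk)).mono_left
    (nhdsWithin_mono _ (inter_subset_inter_left _ hJ))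

theorem IsSolutionOn.forced {m : ℕ} {A B : Matrix (Fin m) (Fin m) ℝ} {θ : ℤ → ℝ}
    {f : ℝ → Vec m → Vec m} {g : ℝ → Vec m} {h : Vec m → Vec m} {J : Set ℝ} {x : ℝ → Vec m}
    (hx : IsSolutionOn A B f g h θ J x) :
    IsForcedSolutionOn A B θ (fun t => f t (x t) + g t) (fun k => h (x (θ k))) J x where
  deriv t ht hr := by simpa only [add_assoc] using hx.deriv t ht hr
  left_cont := hx.left_cont
  jump := hx.jump

theorem IsForcedSolutionOn.sub {m : ℕ} {A B : Matrix (Fin m) (Fin m) ℝ} {θ : ℤ → ℝ}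
    {F F' : ℝ → Vec m} {H H' : ℤ → Vec m} {J : Set ℝ} {w w' : ℝ → Vec m}
    (hw : IsForcedSolutionOn A B θ F H J w) (hw' : IsForcedSolutionOn A B θ F' H' J w') :
    IsForcedSolutionOn A B θ (fun t => F t - F' t) (fun k => H k - H' k) J
      (fun t => w t - w' t) where
  deriv t ht hr := by
    refine ((hw.deriv t ht hr).sub (hw'.deriv t ht hr)).congr_deriv ?_
    rw [mulE_sub]; abel
  left_cont k hk := (hw.left_cont k hk).sub (hw'.left_cont k hk)
  jump k hk := by
    convert (hw.jump k hk).sub (hw'.jump k hk) using 2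
    rw [mulE_sub]; abel

theorem notMem_range_of_mem_Ioo {θ : ℤ → ℝ} (hθ : StrictMono θ) {k : ℤ} {t : ℝ}
    (ht : t ∈ Ioo (θ k) (θ (k + 1))) : t ∉ range θ := by
  rintro ⟨j, rfl⟩
  have h1 := hθ.lt_iff_lt.1 ht.1
  have h2 := hθ.lt_iff_lt.1 ht.2
  omega

theorem IsForcedSolutionOn.continuousWithinAt {m : ℕ} {A B : Matrix (Fin m) (Fin m) ℝ}
    {θ : ℤ → ℝ} {F : ℝ → Vec m} {H : ℤ → Vec m} {J : Set ℝ} {w : ℝ → Vec m}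
    (hw : IsForcedSolutionOn A B θ F H J w) {t : ℝ} (ht : t ∈ J) :
    ContinuousWithinAt w (J ∩ Iic t) t := by
  by_cases hr : t ∈ range θ
  · obtain ⟨k, rfl⟩ := hr
    exact hw.left_cont k ht
  · exact (hw.deriv t ht hr).continuousWithinAt.mono inter_subset_left

/-- Solutions are continuous on `[s, r]` when `(s, r]` contains no impulse moment except possibly
`r`. -/
theorem IsForcedSolutionOn.continuousOn {m : ℕ} {A B : Matrix (Fin m) (Fin m) ℝ}
    {θ : ℤ → ℝ} (hθ : StrictMono θ) {F : ℝ → Vec m} {H : ℤ → Vec m} {J : Set ℝ} {w : ℝ → Vec m}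
    (hw : IsForcedSolutionOn A B θ F H J w) {k : ℤ} {s r : ℝ} (hJ : Icc s r ⊆ J)
    (hs : θ k < s) (hr : r ≤ θ (k + 1)) : ContinuousOn w (Icc s r) := by
  intro t ht
  rcases eq_or_lt_of_le ht.2 with h | h
  · subst h
    exact (hw.continuousWithinAt (hJ ht)).mono fun u hu => ⟨hJ hu, hu.2⟩
  · exact (hw.deriv t (hJ ht) (notMem_range_of_mem_Ioo hθ
      ⟨hs.trans_le ht.1, h.trans_le hr⟩)).continuousWithinAt.mono hJ

theorem IsForcedSolutionOn.hasDerivWithinAt_Ici {m : ℕ} {A B : Matrix (Fin m) (Fin m) ℝ}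
    {θ : ℤ → ℝ} (hθ : StrictMono θ) {F : ℝ → Vec m} {H : ℤ → Vec m} {J : Set ℝ} {w : ℝ → Vec m}
    (hw : IsForcedSolutionOn A B θ F H J w) {k : ℤ} {s r t : ℝ} (hJ : Icc s r ⊆ J)
    (hs : θ k < s) (hr : r ≤ θ (k + 1)) (ht : t ∈ Ico s r) :
    HasDerivWithinAt w (mulE A (w t) + F t) (Ici t) t := by
  have h1 := hw.deriv t (hJ ⟨ht.1, ht.2.le⟩) (notMem_range_of_mem_Ioo hθ
    ⟨hs.trans_le ht.1, ht.2.trans_le hr⟩)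
  refine (h1.mono hJ).mono_of_mem_nhdsWithin ?_
  exact mem_of_superset (Icc_mem_nhdsGE ht.2) (Icc_subset_Icc_left ht.1)

theorem IsForcedSolutionOn.exists_norm_le {m : ℕ} {A B : Matrix (Fin m) (Fin m) ℝ}
    {θ : ℤ → ℝ} {F : ℝ → Vec m} {H : ℤ → Vec m} {a b : ℝ} {w : ℝ → Vec m}
    (hw : IsForcedSolutionOn A B θ F H (Icc a b) w) :
    ∃ C : ℝ, ∀ t ∈ Icc a b, ‖w t‖ ≤ C := by
  -- A function with one-sided limits at every point of a compact interval is bounded there.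
  have bdd : ∀ {l : Filter ℝ} {v : Vec m}, Tendsto w l (𝓝 v) →
      ∀ᶠ t in l, ‖w t‖ ≤ ‖v‖ + 1 := fun h => by
    filter_upwards [h.norm.eventually (gt_mem_nhds (lt_add_one _))] with t ht using ht.le
  refine isCompact_Icc.induction_on (p := fun s => ∃ C : ℝ, ∀ t ∈ s, ‖w t‖ ≤ C) ⟨0, by simp⟩
    (fun s t hst ⟨C, hC⟩ => ⟨C, fun u hu => hC u (hst hu)⟩)
    (fun s t ⟨C, hC⟩ ⟨D, hD⟩ => ⟨max C D, fun u hu => ?_⟩) fun t ht => ?_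
  · rcases hu with hu | hu
    · exact (hC u hu).trans (le_max_left _ _)
    · exact (hD u hu).trans (le_max_right _ _)
  · suffices h : ∃ C : ℝ, ∀ᶠ u in 𝓝[Icc a b] t, ‖w u‖ ≤ C by
      obtain ⟨C, hC⟩ := h
      exact ⟨_, hC, C, fun u hu => hu⟩
    by_cases hr : t ∈ range θ
    · obtain ⟨k, rfl⟩ := hr
      refine ⟨max (‖w (θ k)‖ + 1) (‖w (θ k) + (mulE B (w (θ k)) + H k)‖ + 1), ?_⟩
      have e : Icc a b = Icc a b ∩ Iic (θ k) ∪ Icc a b ∩ Ioi (θ k) := by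
        rw [← inter_union_distrib_left, Iic_union_Ioi, inter_univ]
      rw [e, nhdsWithin_union, eventually_sup]
      exact ⟨(bdd (hw.left_cont k ht)).mono fun u hu => hu.trans (le_max_left _ _),
        (bdd (hw.jump k ht)).mono fun u hu => hu.trans (le_max_right _ _)⟩
    · exact ⟨_, bdd (hw.deriv t ht hr).continuousWithinAt⟩

theorem countMoments_Ico_left {θ : ℤ → ℝ} (hθ : StrictMono θ) {k : ℤ} {r b : ℝ}
    (hr : r ∈ Ioc (θ k) (θ (k + 1))) :
    countMoments θ (Ico r b) = countMoments θ (Ico (θ (k + 1)) b) := by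
  unfold countMoments
  congr 1
  ext j
  simp only [mem_ofPred_eq, mem_Ico]
  refine and_congr_left fun _ => ⟨fun h => ?_, fun h => hr.2.trans h⟩
  have := hθ.lt_iff_lt.1 (hr.1.trans_le h)
  exact hθ.monotone (by omega)

theorem countMoments_Ico_succ {θ : ℤ → ℝ} {p : ℕ} {ω : ℝ} (hθ : RegularMoments θ p ω)
    {k : ℤ} {b : ℝ} (hb : θ k < b) :
    countMoments θ (Ico (θ k) b) = countMoments θ (Ico (θ (k + 1)) b) + 1 := by
  unfold countMoments
  obtain ⟨c, hc⟩ := hθ.exists_ge b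
  have hfin : {j : ℤ | θ j ∈ Ico (θ (k + 1)) b}.Finite :=
    (finite_Icc (k + 1) c).subset fun j hj => ⟨hθ.strictMono.le_iff_le.1 hj.1,
      (hθ.strictMono.lt_iff_lt.1 (hj.2.trans_le hc)).le⟩
  rw [← ncard_insert_of_notMem (a := k) (by simp [hθ.strictMono.le_iff_le]) hfin]
  congr 1
  ext j
  simp only [mem_ofPred_eq, mem_insert_iff, mem_Ico, hθ.strictMono.le_iff_le]
  constructor
  · rintro ⟨h1, h2⟩
    rcases eq_or_lt_of_le h1 with h | h
    · exact Or.inl h.symm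
    · exact Or.inr ⟨h, h2⟩
  · rintro (rfl | ⟨h1, h2⟩)
    · exact ⟨le_rfl, hb⟩
    · exact ⟨by omega, h2⟩

/-! ### Comparison with a scalar supersolution -/

/-- The matriciant `U(b, ·)` continued from `(θ_k, θ_{k+1}]` to a smooth function of `r`. -/
noncomputable def matriciantPiece {m : ℕ} (A B : Matrix (Fin m) (Fin m) ℝ) (θ : ℤ → ℝ)
    (b : ℝ) (k : ℤ) (r : ℝ) : Matrix (Fin m) (Fin m) ℝ :=
  NormedSpace.exp ((b - r) • A) * (1 + B) ^ countMoments θ (Ico (θ (k + 1)) b)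

section Comparison

variable {m : ℕ} {A B : Matrix (Fin m) (Fin m) ℝ} {θ : ℤ → ℝ} {p : ℕ} {ω N lam a b : ℝ}
  {F : ℝ → Vec m} {H : ℤ → Vec m} {w : ℝ → Vec m}

theorem matriciantPiece_eq (hθ : StrictMono θ) {k : ℤ} {r : ℝ}
    (hr : r ∈ Ioc (θ k) (θ (k + 1))) : matriciantPiece A B θ b k r = matriciant A B θ b r := by
  rw [matriciantPiece, matriciant, countMoments_Ico_left hθ hr]

theorem matriciantPiece_self {k : ℤ} (hb : b ≤ θ (k + 1)) : matriciantPiece A B θ b k b = 1 := by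
  simp [matriciantPiece, countMoments, Ico_eq_empty_of_le hb]

theorem hasDerivAt_matriciantPiece (hAB : Commute A B) (k : ℤ) (r : ℝ) :
    HasDerivAt (matriciantPiece A B θ b k) (-(matriciantPiece A B θ b k r * A)) r := by
  refine ((hasDerivAt_exp_sub_smul A b r).mul_const _).congr_deriv ?_
  have hc : Commute A ((1 + B) ^ countMoments θ (Ico (θ (k + 1)) b)) :=
    ((Commute.one_right A).add_right hAB).pow_right _
  rw [matriciantPiece, neg_mul, mul_assoc, mul_assoc, hc.eq]

theorem matriciantPiece_pred (hθ : RegularMoments θ p ω) {k : ℤ} (hb : θ k < b) :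
    matriciantPiece A B θ b (k - 1) (θ k) = matriciantPiece A B θ b k (θ k) * (1 + B) := by
  rw [matriciantPiece, matriciantPiece, sub_add_cancel, countMoments_Ico_succ hθ hb, pow_succ,
    mul_assoc]

/-- The exponential bound of the matriciant extends to the right limit at `θ_k` by continuity. -/
theorem norm_matriciantPiece_le (hθ : StrictMono θ) (hAB : Commute A B)
    (hU : ∀ t s : ℝ, s ≤ t → ‖matriciant A B θ t s‖ ≤ N * Real.exp (-lam * (t - s)))
    {k : ℤ} {r : ℝ} (hr : r ∈ Icc (θ k) (θ (k + 1))) (hrb : r ≤ b) (hkb : θ k < b) :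
    ‖matriciantPiece A B θ b k r‖ ≤ N * Real.exp (-lam * (b - r)) := by
  rcases eq_or_lt_of_le hr.1 with h | h
  · subst h
    have h1 : Tendsto (fun s => ‖matriciantPiece A B θ b k s‖) (𝓝[>] (θ k))
        (𝓝 ‖matriciantPiece A B θ b k (θ k)‖) :=
      (hasDerivAt_matriciantPiece hAB k (θ k)).continuousAt.norm.continuousWithinAt
    have h2 : Tendsto (fun s => N * Real.exp (-lam * (b - s))) (𝓝[>] (θ k))
        (𝓝 (N * Real.exp (-lam * (b - θ k)))) :=
      (by fun_prop : Continuous fun s => N * Real.exp (-lam * (b - s))).continuousWithinAt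
    refine le_of_tendsto_of_tendsto h1 h2 ?_
    filter_upwards [Ioo_mem_nhdsGT hkb,
      Ioo_mem_nhdsGT (hθ (by omega : k < k + 1))] with s hs hs'
    rw [matriciantPiece_eq hθ ⟨hs.1, hs'.2.le⟩]
    exact hU b s hs.2.le
  · rw [matriciantPiece_eq hθ ⟨h, hr.2⟩]
    exact hU b r hrb

/-- One impulse-free step of the comparison: along `r ↦ U(b, r) w(r)` only the forcing is left in
the derivative, so the scalar bound `e^{-λ(b-r)} ρ(r)` propagates from the right limit at `s`. -/
theorem IsForcedSolutionOn.norm_matriciantPiece_le_of_tendsto (hθ : StrictMono θ)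
    (hAB : Commute A B)
    (hU : ∀ t s : ℝ, s ≤ t → ‖matriciant A B θ t s‖ ≤ N * Real.exp (-lam * (t - s)))
    (hw : IsForcedSolutionOn A B θ F H (Icc a b) w) {k : ℤ} {ρ ρ' : ℝ → ℝ}
    (hρ : ∀ t, HasDerivAt ρ (ρ' t) t)
    (hF : ∀ t ∈ Icc a b, t ∈ Ioo (θ k) (θ (k + 1)) → N * ‖F t‖ ≤ ρ' t + lam * ρ t)
    {s L : ℝ} (has : a ≤ s) (hks : θ k ≤ s)
    (hlim : Tendsto (fun r => ‖mulE (matriciantPiece A B θ b k r) (w r)‖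
      - Real.exp (-lam * (b - r)) * ρ r) (𝓝[>] s) (𝓝 L)) (hL : L ≤ 0)
    {r : ℝ} (hsr : s < r) (hrb : r ≤ b) (hrk : r ≤ θ (k + 1)) :
    ‖mulE (matriciantPiece A B θ b k r) (w r)‖ ≤ Real.exp (-lam * (b - r)) * ρ r := by
  set Y : ℝ → Vec m := fun r => mulE (matriciantPiece A B θ b k r) (w r)
  set E : ℝ → ℝ := fun r => Real.exp (-lam * (b - r)) * ρ r
  have hE : ∀ t, HasDerivAt E (Real.exp (-lam * (b - t)) * (ρ' t + lam * ρ t)) t := fun t => by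
    have h1 : HasDerivAt (fun r => Real.exp (-lam * (b - r)))
        (Real.exp (-lam * (b - t)) * lam) t := by
      have := (((hasDerivAt_id t).const_sub b).const_mul (-lam)).exp
      simpa using this
    refine (h1.mul (hρ t)).congr_deriv ?_
    ring
  have key : ∀ s' ∈ Ioo s r, ‖Y r‖ - E r ≤ ‖Y s'‖ - E s' := by
    intro s' hs'
    have hks' : θ k < s' := hks.trans_lt hs'.1
    have hJ : Icc s' r ⊆ Icc a b := Icc_subset_Icc (has.trans hs'.1.le) hrb
    have hcont : ContinuousOn Y (Icc s' r) := by
      intro t ht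
      have h1 : Tendsto (matriciantPiece A B θ b k) (𝓝[Icc s' r] t)
          (𝓝 (matriciantPiece A B θ b k t)) :=
        (hasDerivAt_matriciantPiece hAB k t).continuousAt.continuousWithinAt
      exact tendsto_mulE h1 (hw.continuousOn hθ hJ hks' hrk t ht)
    have hder : ∀ t ∈ Ico s' r, HasDerivWithinAt Y
        (mulE (matriciantPiece A B θ b k t) (F t)) (Ici t) t := fun t ht => by
      refine ((hasDerivAt_matriciantPiece hAB k t).hasDerivWithinAt.mulE
        (hw.hasDerivWithinAt_Ici hθ hJ hks' hrk ht)).congr_deriv ?_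
      rw [mulE_add, neg_mulE, mulE_mul]; abel
    have := image_norm_le_of_norm_deriv_right_le_deriv_boundary hcont hder
      (B := fun t => E t + (‖Y s'‖ - E s')) (by simp)
      (fun t => (hE t).add_const _) (fun t ht => ?_) (right_mem_Icc.2 hs'.2.le)
    · linarith
    · have ht' : t ∈ Icc a b := hJ ⟨ht.1, ht.2.le⟩
      have hk : t ∈ Ioo (θ k) (θ (k + 1)) := ⟨hks'.trans_le ht.1, ht.2.trans_le hrk⟩
      calc _ ≤ ‖matriciantPiece A B θ b k t‖ * ‖F t‖ := norm_mulE_le _ _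
        _ ≤ N * Real.exp (-lam * (b - t)) * ‖F t‖ := by
          gcongr
          exact norm_matriciantPiece_le hθ hAB hU ⟨hk.1.le, hk.2.le⟩ ht'.2 (hk.1.trans_le ht'.2)
        _ = Real.exp (-lam * (b - t)) * (N * ‖F t‖) := by ring
        _ ≤ _ := by gcongr; exact hF t ht' hk
  have : ‖Y r‖ - E r ≤ L := ge_of_tendsto hlim (by
    filter_upwards [Ioo_mem_nhdsGT hsr] with s' hs' using key s' hs')
  linarith

/-- Comparison principle: if the scalar function `ρ`, given by `ρ k` on `(θ_k, θ_{k+1}]`, dominates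
the forcing in the sense of `N‖F‖ ≤ ρ' + λρ` between the impulses and of `N‖H_k‖ ≤ Δρ` at them,
then the initial bound `N‖w(a)‖ ≤ ρ(a)` implies `‖w‖ ≤ ρ` later.  This replaces the variation of
constants formula. -/
theorem IsForcedSolutionOn.norm_le_of_supersolution_right (hθ : RegularMoments θ p ω)
    (hAB : Commute A B)
    (hU : ∀ t s : ℝ, s ≤ t → ‖matriciant A B θ t s‖ ≤ N * Real.exp (-lam * (t - s)))
    (hw : IsForcedSolutionOn A B θ F H (Icc a b) w) {ρ ρ' : ℤ → ℝ → ℝ}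
    (hρ : ∀ k t, HasDerivAt (ρ k) (ρ' k t) t)
    {j : ℤ} (haj : a ∈ Ioc (θ j) (θ (j + 1))) (h0 : N * ‖w a‖ ≤ ρ j a)
    (hF : ∀ k, ∀ t ∈ Icc a b, t ∈ Ioo (θ k) (θ (k + 1)) → N * ‖F t‖ ≤ ρ' k t + lam * ρ k t)
    (hH : ∀ k, θ k ∈ Icc a b → N * ‖H k‖ ≤ ρ k (θ k) - ρ (k - 1) (θ k))
    {k : ℤ} (hab : a ≤ b) (hbk : b ∈ Ioc (θ k) (θ (k + 1))) : ‖w b‖ ≤ ρ k b := by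
  have hmono := hθ.strictMono
  set Y : ℤ → ℝ → Vec m := fun k r => mulE (matriciantPiece A B θ b k r) (w r) with hY
  set E : ℤ → ℝ → ℝ := fun k r => Real.exp (-lam * (b - r)) * ρ k r with hE
  have hEc : ∀ k, Continuous (E k) := fun k => by
    have : Continuous (ρ k) := continuous_iff_continuousAt.2 fun t => (hρ k t).continuousAt
    fun_prop
  have start : ‖Y j a‖ ≤ E j a := by
    calc _ ≤ ‖matriciantPiece A B θ b j a‖ * ‖w a‖ := norm_mulE_le _ _
      _ ≤ N * Real.exp (-lam * (b - a)) * ‖w a‖ := by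
        gcongr
        exact norm_matriciantPiece_le hmono hAB hU ⟨haj.1.le, haj.2⟩ hab (haj.1.trans_le hab)
      _ = Real.exp (-lam * (b - a)) * (N * ‖w a‖) := by ring
      _ ≤ _ := by simp only [hE]; gcongr
  have claim : ∀ n : ℕ, ∀ r ∈ Icc a b, r ∈ Ioc (θ (j + n)) (θ (j + n + 1)) →
      ‖Y (j + n) r‖ ≤ E (j + n) r := by
    intro n
    induction n with
    | zero =>
      intro r hr hrj
      simp only [Nat.cast_zero, add_zero] at hrj ⊢
      rcases eq_or_lt_of_le hr.1 with h | h
      · subst h; exact start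
      · have hlt : a < θ (j + 1) := h.trans_le hrj.2
        have hwlim : Tendsto w (𝓝[>] a) (𝓝 (w a)) := by
          have := (hw.hasDerivWithinAt_Ici hmono (s := a) (r := r) (Icc_subset_Icc_right hr.2)
            haj.1 hrj.2 ⟨le_rfl, h⟩).continuousWithinAt
          exact this.mono Ioi_subset_Ici_self
        have hUlim : Tendsto (matriciantPiece A B θ b j) (𝓝[>] a)
            (𝓝 (matriciantPiece A B θ b j a)) :=
          (hasDerivAt_matriciantPiece hAB j a).continuousAt.continuousWithinAt
        have hYlim : Tendsto (Y j) (𝓝[>] a) (𝓝 (Y j a)) := tendsto_mulE hUlim hwlim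
        exact hw.norm_matriciantPiece_le_of_tendsto hmono hAB hU (hρ j) (hF j) le_rfl haj.1.le
          (hYlim.norm.sub (hEc j).continuousWithinAt) (sub_nonpos.2 start) h hr.2 hrj.2
    | succ n ih =>
      intro r hr hrj
      set k := j + ((n + 1 : ℕ) : ℤ) with hk
      have hk1 : j + (n : ℤ) = k - 1 := by rw [hk]; push_cast; ring
      have hak : a ≤ θ k := haj.2.trans (hmono.monotone (by rw [hk]; push_cast; omega))
      have hkb : θ k < b := hrj.1.trans_le hr.2
      have hprev : ‖Y (k - 1) (θ k)‖ ≤ E (k - 1) (θ k) := by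
        rw [← hk1]
        refine ih _ ⟨hak, hkb.le⟩ ⟨hmono (by omega), hmono.monotone (by omega)⟩
      have hwlim : Tendsto w (𝓝[>] (θ k)) (𝓝 (w (θ k) + (mulE B (w (θ k)) + H k))) := by
        refine (hw.jump k ⟨hak, hkb.le⟩).mono_left (nhdsWithin_le_of_mem ?_)
        exact mem_of_superset (Ioc_mem_nhdsGT hkb) fun u hu => ⟨⟨hak.trans hu.1.le, hu.2⟩, hu.1⟩
      have hUlim : Tendsto (matriciantPiece A B θ b k) (𝓝[>] (θ k))
          (𝓝 (matriciantPiece A B θ b k (θ k))) :=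
        (hasDerivAt_matriciantPiece hAB k (θ k)).continuousAt.continuousWithinAt
      have hYlim : Tendsto (Y k) (𝓝[>] (θ k)) (𝓝 (mulE (matriciantPiece A B θ b k (θ k))
          (w (θ k) + (mulE B (w (θ k)) + H k)))) := tendsto_mulE hUlim hwlim
      refine hw.norm_matriciantPiece_le_of_tendsto hmono hAB hU (hρ k) (hF k) hak le_rfl
          (hYlim.norm.sub (hEc k).continuousWithinAt) (sub_nonpos.2 ?_) hrj.1 hr.2 hrj.2
      -- The jump of `U(b, r) w(r)` at `θ_k` is `U(b, θ_k+) H_k`.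
      have e : mulE (matriciantPiece A B θ b k (θ k)) (w (θ k) + (mulE B (w (θ k)) + H k))
          = Y (k - 1) (θ k) + mulE (matriciantPiece A B θ b k (θ k)) (H k) := by
        simp only [hY]
        rw [matriciantPiece_pred hθ hkb, mulE_mul, add_mulE, mulE_one, ← mulE_add, add_assoc]
      rw [e]
      calc _ ≤ ‖Y (k - 1) (θ k)‖ + ‖mulE (matriciantPiece A B θ b k (θ k)) (H k)‖ :=
            norm_add_le _ _
        _ ≤ E (k - 1) (θ k) + N * Real.exp (-lam * (b - θ k)) * ‖H k‖ := by
          refine add_le_add hprev ((norm_mulE_le _ _).trans ?_)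
          gcongr
          exact norm_matriciantPiece_le hmono hAB hU ⟨le_rfl, hmono.monotone (by omega)⟩ hkb.le hkb
        _ = Real.exp (-lam * (b - θ k)) * (ρ (k - 1) (θ k) + N * ‖H k‖) := by
          simp only [hE]; ring
        _ ≤ E k (θ k) := by
          simp only [hE]
          gcongr
          linarith [hH k ⟨hak, hkb.le⟩]
  have hjk : j ≤ k := by
    have := hmono.lt_iff_lt.1 (haj.1.trans_le (hab.trans hbk.2))
    omega
  obtain ⟨n, rfl⟩ := Int.le.dest hjk
  have := claim n b (right_mem_Icc.2 hab) hbk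
  simpa [hY, hE, matriciantPiece_self hbk.2, mulE_one] using this

theorem IsForcedSolutionOn.norm_le_of_supersolution (hθ : RegularMoments θ p ω)
    (hAB : Commute A B)
    (hU : ∀ t s : ℝ, s ≤ t → ‖matriciant A B θ t s‖ ≤ N * Real.exp (-lam * (t - s)))
    (hw : IsForcedSolutionOn A B θ F H (Icc a b) w) {ρ ρ' : ℤ → ℝ → ℝ}
    (hρ : ∀ k t, HasDerivAt (ρ k) (ρ' k t) t)
    {j : ℤ} (haj : a ∈ Ioc (θ j) (θ (j + 1))) (h0 : N * ‖w a‖ ≤ ρ j a)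
    (hF : ∀ k, ∀ t ∈ Icc a b, t ∈ Ioo (θ k) (θ (k + 1)) → N * ‖F t‖ ≤ ρ' k t + lam * ρ k t)
    (hH : ∀ k, θ k ∈ Icc a b → N * ‖H k‖ ≤ ρ k (θ k) - ρ (k - 1) (θ k))
    {k : ℤ} {t : ℝ} (ht : t ∈ Icc a b) (htk : t ∈ Ioc (θ k) (θ (k + 1))) : ‖w t‖ ≤ ρ k t := by
  have hsub : Icc a t ⊆ Icc a b := Icc_subset_Icc_right ht.2
  exact (hw.mono hsub).norm_le_of_supersolution_right hθ hAB hU hρ haj h0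
    (fun k s hs => hF k s (hsub hs)) (fun k hk => hH k (hsub hk)) ht.1 htk

end Comparison

/-! ### Exponential estimate for Lipschitz perturbations -/

section Estimate

variable {m : ℕ} {A B : Matrix (Fin m) (Fin m) ℝ} {θ : ℤ → ℝ} {p : ℕ} {ω N lam Lf Lh : ℝ}

/-- A nonlinear version of the comparison principle, for forcings bounded by `L‖w‖ + ε`.  The
slack `q < 1` in the conditions on `ρ` makes each use of the linear principle shrink the excess of
`‖w‖` over `ρ` by the factor `q`; so no Gronwall inequality is needed. -/
theorem IsForcedSolutionOn.norm_le_of_supersolution_lipschitz (hθ : RegularMoments θ p ω)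
    (hAB : Commute A B) (hN : 0 < N) (hLf : 0 < Lf) (hLh : 0 < Lh)
    (hU : ∀ t s : ℝ, s ≤ t → ‖matriciant A B θ t s‖ ≤ N * Real.exp (-lam * (t - s)))
    {a b ε q r₀ : ℝ} {F : ℝ → Vec m} {H : ℤ → Vec m} {w : ℝ → Vec m}
    (hw : IsForcedSolutionOn A B θ F H (Icc a b) w)
    (hF : ∀ t ∈ Icc a b, t ∉ range θ → ‖F t‖ ≤ Lf * ‖w t‖ + ε)
    (hH : ∀ k, θ k ∈ Icc a b → ‖H k‖ ≤ Lh * ‖w (θ k)‖ + ε)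
    {ρ ρ' : ℤ → ℝ → ℝ} (hρ : ∀ k t, HasDerivAt (ρ k) (ρ' k t) t)
    (hq0 : 0 < q) (hq1 : q < 1) (hr₀ : 0 < r₀)
    (hpos : ∀ k, ∀ t ∈ Icc a b, t ∈ Icc (θ k) (θ (k + 1)) → r₀ ≤ ρ k t)
    (hρf : ∀ k, ∀ t ∈ Icc a b, t ∈ Icc (θ k) (θ (k + 1)) → ε ≤ Lf * (1 / q - 1) * ρ k t)
    (hρh : ∀ k, ∀ t ∈ Icc a b, t ∈ Icc (θ k) (θ (k + 1)) → ε ≤ Lh * (1 / q - 1) * ρ k t)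
    (hρ' : ∀ k, ∀ t ∈ Icc a b, t ∈ Icc (θ k) (θ (k + 1)) →
      N * (Lf / q) * ρ k t ≤ ρ' k t + lam * ρ k t)
    (hjump : ∀ k, θ k ∈ Icc a b →
      N * (Lh / q) * ρ (k - 1) (θ k) ≤ ρ k (θ k) - ρ (k - 1) (θ k))
    {j : ℤ} (haj : a ∈ Ioc (θ j) (θ (j + 1))) (h0 : N * ‖w a‖ ≤ ρ j a)
    {k : ℤ} {t : ℝ} (ht : t ∈ Icc a b) (htk : t ∈ Ioc (θ k) (θ (k + 1))) : ‖w t‖ ≤ ρ k t := by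
  obtain ⟨D, hD⟩ := hw.exists_norm_le
  set C := |D| / r₀
  have hC : 0 ≤ C := by positivity
  have claim : ∀ n : ℕ, ∀ k, ∀ t ∈ Icc a b, t ∈ Ioc (θ k) (θ (k + 1)) →
      ‖w t‖ ≤ (1 + C * q ^ n) * ρ k t := by
    intro n
    induction n with
    | zero =>
      intro k t ht htk
      have h1 := hpos k t ht (Ioc_subset_Icc_self htk)
      calc ‖w t‖ ≤ |D| := (hD t ht).trans (le_abs_self D)
        _ = C * r₀ := by simp only [C]; field_simp
        _ ≤ C * ρ k t := by gcongr
        _ ≤ (1 + C * q ^ 0) * ρ k t := by rw [pow_zero]; linarith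
    | succ n ih =>
      intro k t ht htk
      have hqn : 0 ≤ C * q ^ (n + 1) := by positivity
      refine hw.norm_le_of_supersolution hθ hAB hU (ρ := fun k t => (1 + C * q ^ (n + 1)) * ρ k t)
        (ρ' := fun k t => (1 + C * q ^ (n + 1)) * ρ' k t) (fun k t => (hρ k t).const_mul _) haj
        ?_ (fun k t ht htk => ?_) (fun k hk => ?_) ht htk
      · have := hpos j a ⟨le_rfl, ht.1.trans ht.2⟩ (Ioc_subset_Icc_self haj)
        nlinarith
      · have hk' := Ioo_subset_Icc_self htk
        calc N * ‖F t‖ ≤ N * (Lf * ((1 + C * q ^ n) * ρ k t) + Lf * (1 / q - 1) * ρ k t) := by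
              gcongr
              refine (hF t ht (notMem_range_of_mem_Ioo hθ.strictMono htk)).trans
                (add_le_add ?_ (hρf k t ht hk'))
              gcongr
              exact ih k t ht (Ioo_subset_Ioc_self htk)
          _ = (1 + C * q ^ (n + 1)) * (N * (Lf / q) * ρ k t) := by
              field_simp; ring
          _ ≤ (1 + C * q ^ (n + 1)) * (ρ' k t + lam * ρ k t) := by
              gcongr; exact hρ' k t ht hk'
          _ = _ := by ring
      · have hk' : θ k ∈ Ioc (θ (k - 1)) (θ (k - 1 + 1)) :=
          ⟨hθ.strictMono (by omega), by rw [sub_add_cancel]⟩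
        calc N * ‖H k‖ ≤ N * (Lh * ((1 + C * q ^ n) * ρ (k - 1) (θ k))
                + Lh * (1 / q - 1) * ρ (k - 1) (θ k)) := by
              gcongr
              refine (hH k hk).trans
                (add_le_add ?_ (hρh (k - 1) _ hk (Ioc_subset_Icc_self hk')))
              gcongr
              exact ih (k - 1) _ hk hk'
          _ = (1 + C * q ^ (n + 1)) * (N * (Lh / q) * ρ (k - 1) (θ k)) := by
              field_simp; ring
          _ ≤ (1 + C * q ^ (n + 1)) * (ρ k (θ k) - ρ (k - 1) (θ k)) := by
              gcongr; exact hjump k hk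
          _ = _ := by ring
  have hlim : Tendsto (fun n : ℕ => (1 + C * q ^ n) * ρ k t) atTop (𝓝 ((1 + C * 0) * ρ k t)) :=
    (((tendsto_pow_atTop_nhds_zero_of_lt_one hq0.le hq1).const_mul C).const_add 1).mul_const _
  rw [mul_zero, add_zero, one_mul] at hlim
  exact ge_of_tendsto' hlim fun n => claim n k t ht htk

theorem RegularMoments.pos (hθ : RegularMoments θ p ω) : 0 < p := by
  rcases Nat.eq_zero_or_pos p with h | h
  · have := hθ.shift 0
    have := hθ.period_pos
    simp_all
  · exact h

theorem RegularMoments.succ_le (hθ : RegularMoments θ p ω) (k : ℤ) : θ (k + 1) ≤ θ k + ω := by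
  rw [← hθ.shift]
  exact hθ.strictMono.monotone (by have := hθ.pos; omega)

theorem exists_abs_le_of_periodic {u : ℤ → ℝ} (hp : 0 < p) (hu : ∀ k, u (k + p) = u k) :
    ∃ D : ℝ, ∀ k, |u k| ≤ D := by
  refine ⟨∑ i ∈ Finset.range p, |u i|, fun k => ?_⟩
  have hper : Function.Periodic u (p : ℤ) := hu
  have h1 : u k = u (k % p) := by
    have := hper.int_mul (k / p) (k % p)
    rw [← this]
    congr 1
    have := Int.emod_add_mul_ediv k p
    simp only [Int.cast_id]
    linarith
  have hnn : 0 ≤ k % p := Int.emod_nonneg _ (by omega)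
  have hlt : k % p < p := Int.emod_lt_of_pos _ (by omega)
  obtain ⟨i, hi⟩ := Int.eq_ofNat_of_zero_le hnn
  rw [h1, hi]
  exact Finset.single_le_sum (f := fun i : ℕ => |u i|) (fun i _ => abs_nonneg _)
    (Finset.mem_range.2 (by omega))

/-- A perturbation of the linear impulsive system with forcing bounded by `L_f‖w‖ + ε` between the
impulses and by `L_h‖w‖ + ε` at them forgets its initial value at the rate `γ`, up to `O(ε)`; the
constants depend neither on the time interval nor on the solution. -/
def HasExponentialEstimate {m : ℕ} (A B : Matrix (Fin m) (Fin m) ℝ) (θ : ℤ → ℝ)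
    (Lf Lh C γ : ℝ) : Prop :=
  ∀ (a b d ε : ℝ) (F : ℝ → Vec m) (H : ℤ → Vec m) (w : ℝ → Vec m), 0 < d → 0 ≤ ε →
    IsForcedSolutionOn A B θ F H (Icc a b) w →
    (∀ t ∈ Icc a b, t ∉ range θ → ‖F t‖ ≤ Lf * ‖w t‖ + ε) →
    (∀ k, θ k ∈ Icc a b → ‖H k‖ ≤ Lh * ‖w (θ k)‖ + ε) → ‖w a‖ ≤ d →
    ∀ t ∈ Icc a b, ‖w t‖ ≤ C * (d * Real.exp (-γ * (t - a)) + ε)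

/-- The exponential estimate holds under the condition `N L_f + (p/ω) ln(1 + N L_h) < λ`.  The supersolution is
`ρ_k(t) = (K₁ e^{-γ(t-a)} + K₂) e^{kℓ - ct}` with `ℓ = ln(1 + N L_h / q)` and `c = (p/ω) ℓ`: the
last factor is bounded above and below, since `k` grows like `(p/ω) t`. -/
theorem exists_exponential_estimate (hθ : RegularMoments θ p ω)
    (hAB : Commute A B) (hN : 0 < N) (hLf : 0 < Lf) (hLh : 0 < Lh)
    (hU : ∀ t s : ℝ, s ≤ t → ‖matriciant A B θ t s‖ ≤ N * Real.exp (-lam * (t - s)))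
    (hA6 : N * Lf + p / ω * Real.log (1 + N * Lh) < lam) :
    ∃ C > (0 : ℝ), ∃ γ > (0 : ℝ), HasExponentialEstimate A B θ Lf Lh C γ := by
  have hω := hθ.period_pos
  have hp := hθ.pos
  obtain ⟨q, hq, hq0, hq1⟩ : ∃ q : ℝ, N * (Lf / q) + p / ω * Real.log (1 + N * (Lh / q)) < lam ∧
      0 < q ∧ q < 1 := by
    have hc : ContinuousAt
        (fun q : ℝ => N * (Lf / q) + p / ω * Real.log (1 + N * (Lh / q))) 1 := by
      have h1 : ContinuousAt (fun q : ℝ => Lf / q) 1 :=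
        continuousAt_const.div continuousAt_id one_ne_zero
      have h2 : ContinuousAt (fun q : ℝ => Lh / q) 1 :=
        continuousAt_const.div continuousAt_id one_ne_zero
      have h3 : (0 : ℝ) < 1 + N * (Lh / 1) := by positivity
      exact (continuousAt_const.mul h1).add (continuousAt_const.mul
        ((continuousAt_const.add (continuousAt_const.mul h2)).log h3.ne'))
    have h1 : ∀ᶠ q : ℝ in 𝓝[<] 1,
        N * (Lf / q) + p / ω * Real.log (1 + N * (Lh / q)) < lam :=
      (hc.eventually (gt_mem_nhds (by simpa using hA6))).filter_mono nhdsWithin_le_nhds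
    obtain ⟨q, h, h'⟩ := (h1.and (Ioo_mem_nhdsLT zero_lt_one)).exists
    exact ⟨q, h, h'.1, h'.2⟩
  set β := N * (Lh / q) with hβ
  have hβ0 : 0 < β := by positivity
  set l := Real.log (1 + β) with hl
  have hl0 : 0 < l := Real.log_pos (by linarith)
  set c := p / ω * l with hc
  have hc0 : 0 < c := by positivity
  set γ := lam - N * (Lf / q) - c with hγ
  have hγ0 : 0 < γ := by linarith
  obtain ⟨D₀, hD₀⟩ := exists_abs_le_of_periodic (p := p) (u := fun k : ℤ => k * l - c * θ k) hp
    fun k => by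
      rw [hθ.shift, hc]
      push_cast
      field_simp
      ring
  set D := D₀ + c * ω with hD
  have hvD : ∀ k : ℤ, ∀ t ∈ Icc (θ k) (θ (k + 1)), |k * l - c * t| ≤ D := by
    intro k t ht
    have h1 := hD₀ k
    have h2 : c * θ k ≤ c * t := by gcongr; exact ht.1
    have h3 : c * t ≤ c * (θ k + ω) := by gcongr; exact ht.2.trans (hθ.succ_le k)
    rw [abs_le] at h1 ⊢
    have : 0 < c * ω := by positivity
    constructor <;> linarith [h1.1, h1.2]
  have hs : 0 < 1 / q - 1 := by
    rw [sub_pos, lt_div_iff₀ hq0]; linarith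
  set K := 1 / (Lf * (1 / q - 1)) + 1 / (Lh * (1 / q - 1)) with hK
  have hK0 : 0 < K := by positivity
  have hKf : 1 ≤ Lf * (1 / q - 1) * K := by
    have : Lf * (1 / q - 1) * (1 / (Lf * (1 / q - 1))) = 1 :=
      mul_one_div_cancel (by positivity)
    rw [hK, mul_add, this]
    exact le_add_of_nonneg_right (by positivity)
  have hKh : 1 ≤ Lh * (1 / q - 1) * K := by
    have : Lh * (1 / q - 1) * (1 / (Lh * (1 / q - 1))) = 1 :=
      mul_one_div_cancel (by positivity)
    rw [hK, mul_add, this]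
    exact le_add_of_nonneg_left (by positivity)
  refine ⟨(N + K) * Real.exp D * Real.exp D, by positivity, γ, hγ0, ?_⟩
  intro a b d ε F H w hd hε hw hF hH hwa t ht
  obtain ⟨j, hj⟩ := hθ.exists_mem_Ioc a
  obtain ⟨k, hk⟩ := hθ.exists_mem_Ioc t
  set K₁ := N * d * Real.exp D with hK₁
  set K₂ := K * ε * Real.exp D with hK₂
  have hK₁0 : 0 < K₁ := by positivity
  have hK₂0 : 0 ≤ K₂ := by positivity
  set e : ℝ → ℝ := fun t => Real.exp (-γ * (t - a)) with he
  set v : ℤ → ℝ → ℝ := fun k t => Real.exp (k * l - c * t) with hv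
  have he' : ∀ t, HasDerivAt e (-γ * e t) t := fun t => by
    have := (((hasDerivAt_id t).sub_const a).const_mul (-γ)).exp
    simpa [he, mul_comm] using this
  have hv' : ∀ k t, HasDerivAt (v k) (-c * v k t) t := fun k t => by
    have := (((hasDerivAt_id t).const_mul c).const_sub (k * l : ℝ)).exp
    simpa [hv, mul_comm] using this
  have hvlow : ∀ k : ℤ, ∀ t ∈ Icc (θ k) (θ (k + 1)), Real.exp (-D) ≤ v k t := fun k t ht =>
    Real.exp_le_exp.2 (neg_le_of_abs_le (hvD k t ht))
  have hvup : ∀ k : ℤ, ∀ t ∈ Icc (θ k) (θ (k + 1)), v k t ≤ Real.exp D := fun k t ht =>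
    Real.exp_le_exp.2 (le_of_abs_le (hvD k t ht))
  have hDD : Real.exp D * Real.exp (-D) = 1 := by rw [← Real.exp_add]; simp
  have hlow : ∀ k, ∀ t ∈ Icc (θ k) (θ (k + 1)),
      K * ε ≤ (K₁ * e t + K₂) * v k t := by
    intro k t ht
    calc K * ε = K₂ * Real.exp (-D) := by rw [hK₂, mul_assoc, hDD, mul_one]
      _ ≤ (K₁ * e t + K₂) * v k t := by
        have h1 : 0 ≤ K₁ * e t := by positivity
        gcongr
        · linarith
        · exact hvlow k t ht
  have main : ‖w t‖ ≤ (K₁ * e t + K₂) * v k t := by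
    refine hw.norm_le_of_supersolution_lipschitz hθ hAB hN hLf hLh hU hF hH
      (ρ := fun k t => (K₁ * e t + K₂) * v k t)
      (ρ' := fun k t => K₁ * (-γ * e t) * v k t + (K₁ * e t + K₂) * (-c * v k t))
      (r₀ := K₁ * e b * Real.exp (-D))
      (fun k t => (((he' t).const_mul K₁).add_const K₂).mul (hv' k t)) hq0 hq1 (by positivity)
      (fun k t ht htk => ?_) (fun k t ht htk => ?_) (fun k t ht htk => ?_) (fun k t ht htk => ?_)
      (fun k hk => ?_) hj ?_ ht hk
    · have h1 : e b ≤ e t := Real.exp_le_exp.2 (by nlinarith [ht.2])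
      have h2 : K₁ * e b ≤ K₁ * e t := by gcongr
      have h3 := hvlow k t htk
      have h4 : 0 ≤ K₁ * e b := by positivity
      gcongr
      linarith
    · calc ε = 1 * ε := (one_mul ε).symm
        _ ≤ Lf * (1 / q - 1) * K * ε := by gcongr
        _ = Lf * (1 / q - 1) * (K * ε) := by ring
        _ ≤ _ := mul_le_mul_of_nonneg_left (hlow k t htk) (by positivity)
    · calc ε = 1 * ε := (one_mul ε).symm
        _ ≤ Lh * (1 / q - 1) * K * ε := by gcongr
        _ = Lh * (1 / q - 1) * (K * ε) := by ring
        _ ≤ _ := mul_le_mul_of_nonneg_left (hlow k t htk) (by positivity)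
    · have h1 : 0 ≤ γ * (K₂ * v k t) := by positivity
      have h2 : lam = γ + N * (Lf / q) + c := by rw [hγ]; ring
      rw [h2]
      nlinarith
    · have h1 : v k (θ k) = (1 + β) * v (k - 1) (θ k) := by
        have h2 : Real.exp l = 1 + β := Real.exp_log (by linarith)
        simp only [hv]
        rw [← h2, ← Real.exp_add]
        congr 1
        push_cast
        ring
      simp only [h1, ← hβ]
      apply le_of_eq
      ring
    · have h1 := hvlow j a (Ioc_subset_Icc_self hj)
      have h2 : e a = 1 := by simp [he]
      calc N * ‖w a‖ ≤ N * d := by gcongr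
        _ = K₁ * Real.exp (-D) := by rw [hK₁, mul_assoc, hDD, mul_one]
        _ ≤ (K₁ * e a + K₂) * v j a := by
          rw [h2]
          gcongr
          linarith
  have h1 := hvup k t (Ioc_subset_Icc_self hk)
  have h2 : 0 < e t := Real.exp_pos _
  calc ‖w t‖ ≤ (K₁ * e t + K₂) * v k t := main
    _ ≤ (K₁ * e t + K₂) * Real.exp D := by gcongr
    _ = (N * (d * e t) + K * ε) * Real.exp D * Real.exp D := by rw [hK₁, hK₂]; ring
    _ ≤ ((N + K) * (d * e t + ε)) * Real.exp D * Real.exp D := by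
      have h3 : 0 ≤ K * (d * e t) := by positivity
      have h4 : 0 ≤ N * ε := by positivity
      gcongr
      linarith
    _ = _ := by ring

end Estimate

/-! ### Solutions between consecutive impulses -/

section Pieces

variable {m : ℕ} {A B : Matrix (Fin m) (Fin m) ℝ} {θ : ℤ → ℝ} {f : ℝ → Vec m → Vec m}
  {g : ℝ → Vec m} {h : Vec m → Vec m}

theorem exp_smul_mul_exp_sub_smul (A : Matrix (Fin m) (Fin m) ℝ) (s t : ℝ) :
    NormedSpace.exp ((t - s) • A) * NormedSpace.exp ((s - t) • A) = 1 := by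
  rw [← Matrix.exp_add_of_commute _ _ (((Commute.refl A).smul_left _).smul_right _), ← add_smul]
  simp

/-- A bounded Lipschitz perturbation of a linear equation is solvable on every compact interval.
In the variable `y = e^{-A(t-t₀)} x` the vector field is bounded, so that the Picard-Lindelöf
theorem applies on the whole interval at once. -/
theorem exists_hasDerivWithinAt_Icc (A : Matrix (Fin m) (Fin m) ℝ)
    (hf : Continuous (Function.uncurry f)) {Mf Lf : ℝ} (hf_bdd : ∀ t x, ‖f t x‖ ≤ Mf)
    (hLf : 0 ≤ Lf) (hf_lip : ∀ t x₁ x₂, ‖f t x₁ - f t x₂‖ ≤ Lf * ‖x₁ - x₂‖)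
    (v y₀ : Vec m) {t₀ t₁ : ℝ} (ht : t₀ ≤ t₁) :
    ∃ x : ℝ → Vec m, x t₀ = y₀ ∧
      ∀ t ∈ Icc t₀ t₁, HasDerivWithinAt x (mulE A (x t) + f t (x t) + v) (Icc t₀ t₁) t := by
  set P : ℝ → Matrix (Fin m) (Fin m) ℝ := fun t => NormedSpace.exp ((t - t₀) • A) with hP
  set Q : ℝ → Matrix (Fin m) (Fin m) ℝ := fun t => NormedSpace.exp ((t₀ - t) • A) with hQ
  have hPd : ∀ t, HasDerivAt P (A * P t) t := fun t => by
    have h1 : HasDerivAt (fun u : ℝ => NormedSpace.exp (u • A))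
        (A * NormedSpace.exp ((t - t₀) • A)) (t - t₀) :=
      hasDerivAt_exp_smul_const' A (t - t₀)
    exact h1.comp_sub_const t t₀
  have hPc : Continuous P := continuous_iff_continuousAt.2 fun t => (hPd t).continuousAt
  have hQc : Continuous Q :=
    continuous_iff_continuousAt.2 fun t => (hasDerivAt_exp_sub_smul A t₀ t).continuousAt
  obtain ⟨C₁, hC₁⟩ := (isCompact_Icc (a := t₀) (b := t₁)).exists_bound_of_continuousOn
    hPc.continuousOn
  obtain ⟨C₂, hC₂⟩ := (isCompact_Icc (a := t₀) (b := t₁)).exists_bound_of_continuousOn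
    hQc.continuousOn
  have hC₁0 : 0 ≤ C₁ := (norm_nonneg _).trans (hC₁ t₀ ⟨le_rfl, ht⟩)
  have hC₂0 : 0 ≤ C₂ := (norm_nonneg _).trans (hC₂ t₀ ⟨le_rfl, ht⟩)
  have hMf : 0 ≤ Mf := (norm_nonneg _).trans (hf_bdd 0 0)
  set G : ℝ → Vec m → Vec m := fun t y => mulE (Q t) (f t (mulE (P t) y) + v) with hG
  have hpl : IsPicardLindelof G (⟨t₀, le_rfl, ht⟩ : Icc t₀ t₁) y₀
      (Real.toNNReal (C₂ * (Mf + ‖v‖) * (t₁ - t₀))) 0 (Real.toNNReal (C₂ * (Mf + ‖v‖)))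
      (Real.toNNReal (C₂ * (Lf * C₁))) := by
    refine ⟨fun t ht' => LipschitzOnWith.of_dist_le_mul fun y _ y' _ => ?_, fun y _ => ?_,
      fun t ht' y _ => ?_, ?_⟩
    · rw [Real.coe_toNNReal _ (by positivity), dist_eq_norm, dist_eq_norm]
      simp only [hG]
      rw [← mulE_sub, add_sub_add_right_eq_sub]
      calc _ ≤ ‖Q t‖ * ‖f t (mulE (P t) y) - f t (mulE (P t) y')‖ := norm_mulE_le _ _
        _ ≤ C₂ * (Lf * (C₁ * ‖y - y'‖)) := by
          gcongr
          · exact hC₂ t ht'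
          · refine (hf_lip _ _ _).trans ?_
            rw [← mulE_sub]
            gcongr
            refine (norm_mulE_le _ _).trans ?_
            gcongr
            exact hC₁ t ht'
        _ = _ := by ring
    · intro t _
      have h1 : Tendsto (fun t => mulE (P t) y) (𝓝[Icc t₀ t₁] t) (𝓝 (mulE (P t) y)) :=
        tendsto_mulE hPc.continuousWithinAt tendsto_const_nhds
      have h2 : Tendsto (fun t => f t (mulE (P t) y)) (𝓝[Icc t₀ t₁] t)
          (𝓝 (f t (mulE (P t) y))) :=
        (hf.tendsto (t, mulE (P t) y)).comp
          ((tendsto_id.mono_left nhdsWithin_le_nhds).prodMk_nhds h1)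
      exact tendsto_mulE hQc.continuousWithinAt (h2.add_const v)
    · rw [Real.coe_toNNReal _ (by positivity)]
      refine (norm_mulE_le _ _).trans ?_
      gcongr
      · exact hC₂ t ht'
      · exact (norm_add_le _ _).trans (by gcongr; exact hf_bdd _ _)
    · have h1 : 0 ≤ t₁ - t₀ := sub_nonneg.2 ht
      rw [Real.coe_toNNReal _ (by positivity), Real.coe_toNNReal _ (by positivity)]
      simp [h1]
  obtain ⟨y, hy0, hy⟩ := hpl.exists_eq_forall_mem_Icc_hasDerivWithinAt₀
  refine ⟨fun t => mulE (P t) (y t), ?_, fun t ht' => ?_⟩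
  · simp only at hy0
    simp [hP, hy0, mulE_one]
  · refine ((hPd t).hasDerivWithinAt.mulE (hy t ht')).congr_deriv ?_
    simp only [hG]
    rw [← mulE_mul, ← mulE_mul, exp_smul_mul_exp_sub_smul, mulE_one, mulE_mul, add_assoc]

/-- `X` is the trajectory on `[θ_k, θ_{k+1}]` that has the value `z` at `θ_k`, then jumps, and
follows the differential equation up to `θ_{k+1}`. -/
structure IsPieceSolution {m : ℕ} (A B : Matrix (Fin m) (Fin m) ℝ)
    (f : ℝ → Vec m → Vec m) (g : ℝ → Vec m) (h : Vec m → Vec m) (θ : ℤ → ℝ)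
    (k : ℤ) (z : Vec m) (X : ℝ → Vec m) : Prop where
  initial : X (θ k) = z
  jump : Tendsto X (𝓝[>] (θ k)) (𝓝 (z + (mulE B z + h z)))
  deriv : ∀ t ∈ Ioo (θ k) (θ (k + 1)), HasDerivAt X (mulE A (X t) + f t (X t) + g t) t
  left_cont : ContinuousWithinAt X (Iic (θ (k + 1))) (θ (k + 1))

theorem exists_isPieceSolution (A B : Matrix (Fin m) (Fin m) ℝ) (h : Vec m → Vec m)
    (hθ : StrictMono θ) (hf : Continuous (Function.uncurry f)) {Mf Lf : ℝ}
    (hf_bdd : ∀ t x, ‖f t x‖ ≤ Mf) (hLf : 0 ≤ Lf)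
    (hf_lip : ∀ t x₁ x₂, ‖f t x₁ - f t x₂‖ ≤ Lf * ‖x₁ - x₂‖) {k : ℤ} {v : Vec m}
    (hg : ∀ t ∈ Ioc (θ k) (θ (k + 1)), g t = v) (z : Vec m) :
    ∃ X : ℝ → Vec m, IsPieceSolution A B f g h θ k z X := by
  have hlt : θ k < θ (k + 1) := hθ (by omega)
  obtain ⟨x, hx0, hx⟩ := exists_hasDerivWithinAt_Icc A hf hf_bdd hLf hf_lip v
    (z + (mulE B z + h z)) hlt.le
  have hev : ∀ t, θ k < t → Function.update x (θ k) z =ᶠ[𝓝 t] x := fun t ht => by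
    filter_upwards [lt_mem_nhds ht] with u hu
    exact Function.update_of_ne (ne_of_gt hu) _ _
  refine ⟨Function.update x (θ k) z, Function.update_self .., ?_, fun t ht => ?_, ?_⟩
  · have h1 : Tendsto x (𝓝[>] (θ k)) (𝓝 (x (θ k))) := by
      refine (hx (θ k) ⟨le_rfl, hlt.le⟩).continuousWithinAt.mono_left
        (nhdsWithin_le_of_mem (mem_of_superset (Ioc_mem_nhdsGT hlt) Ioc_subset_Icc_self))
    rw [hx0] at h1
    refine h1.congr' ?_
    filter_upwards [self_mem_nhdsWithin] with u hu
    exact (Function.update_of_ne (ne_of_gt hu) _ _).symm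
  · rw [Function.update_of_ne (ne_of_gt ht.1), hg t (Ioo_subset_Ioc_self ht)]
    exact ((hx t (Ioo_subset_Icc_self ht)).hasDerivAt
      (Icc_mem_nhds ht.1 ht.2)).congr_of_eventuallyEq (hev t ht.1)
  · have h1 : ContinuousWithinAt x (Iic (θ (k + 1))) (θ (k + 1)) :=
      (hx _ ⟨hlt.le, le_rfl⟩).continuousWithinAt.mono_left
        (nhdsWithin_le_of_mem (mem_of_superset (Ioc_mem_nhdsLE hlt) Ioc_subset_Icc_self))
    exact h1.congr_of_eventuallyEq ((hev _ hlt).filter_mono nhdsWithin_le_nhds)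
      (Function.update_of_ne (ne_of_gt hlt) _ _)

theorem IsPieceSolution.isSolutionOn (hθ : StrictMono θ) {k : ℤ} {z : Vec m} {X : ℝ → Vec m}
    (hX : IsPieceSolution A B f g h θ k z X) :
    IsSolutionOn A B f g h θ (Icc (θ k) (θ (k + 1))) X := by
  have hj : ∀ j : ℤ, θ j ∈ Icc (θ k) (θ (k + 1)) → j = k ∨ j = k + 1 := fun j hj => by
    have h1 := hθ.le_iff_le.1 hj.1
    have h2 := hθ.le_iff_le.1 hj.2
    omega
  refine ⟨fun t ht hr => ?_, fun j hj' => ?_, fun j hj' => ?_⟩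
  · exact (hX.deriv t ⟨lt_of_le_of_ne ht.1 fun e => hr ⟨_, e⟩,
      lt_of_le_of_ne ht.2 fun e => hr ⟨_, e.symm⟩⟩).hasDerivWithinAt
  · rcases hj j hj' with rfl | rfl
    · exact continuousWithinAt_singleton.mono fun u hu => le_antisymm hu.2 hu.1.1
    · exact hX.left_cont.mono inter_subset_right
  · rcases hj j hj' with rfl | rfl
    · rw [hX.initial]
      exact hX.jump.mono_left (nhdsWithin_mono _ inter_subset_right)
    · have : Icc (θ k) (θ (k + 1)) ∩ Ioi (θ (k + 1)) = ∅ :=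
        eq_empty_of_forall_notMem fun u hu => not_lt.2 hu.1.2 hu.2
      rw [this, nhdsWithin_empty]
      exact tendsto_bot

/-- Trajectories on the intervals `[θ_k, θ_{k+1}]` with matching values at the impulse moments
in `J` form a solution on `J`. -/
theorem isSolutionOn_of_pieces {p : ℕ} {ω : ℝ} (hθ : RegularMoments θ p ω) {z : ℤ → Vec m}
    {X : ℤ → ℝ → Vec m} (hX : ∀ k, IsPieceSolution A B f g h θ k (z k) (X k)) {x : ℝ → Vec m}
    (hx : ∀ k, ∀ t ∈ Ioc (θ k) (θ (k + 1)), x t = X k t) {J : Set ℝ}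
    (hz : ∀ k, θ (k + 1) ∈ J → z (k + 1) = X k (θ (k + 1))) :
    IsSolutionOn A B f g h θ J x := by
  have hmono := hθ.strictMono
  have hlt : ∀ k, θ k < θ (k + 1) := fun k => hmono (by omega)
  have hend : ∀ k, x (θ (k + 1)) = X k (θ (k + 1)) := fun k => hx k _ ⟨hlt k, le_rfl⟩
  refine ⟨fun t _ hr => ?_, fun j _ => ?_, fun j hj => ?_⟩
  · obtain ⟨k, hk⟩ := hθ.exists_mem_Ioc t
    have hk' : t ∈ Ioo (θ k) (θ (k + 1)) := ⟨hk.1, lt_of_le_of_ne hk.2 fun e => hr ⟨_, e.symm⟩⟩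
    have hev : x =ᶠ[𝓝 t] X k := by
      filter_upwards [Ioo_mem_nhds hk'.1 hk'.2] with u hu using hx k u (Ioo_subset_Ioc_self hu)
    rw [hx k t hk]
    exact (((hX k).deriv t hk').congr_of_eventuallyEq hev).hasDerivWithinAt
  · obtain ⟨k, rfl⟩ : ∃ k, j = k + 1 := ⟨j - 1, by ring⟩
    refine ((hX k).left_cont.congr_of_eventuallyEq ?_ (hend k)).mono inter_subset_right
    filter_upwards [Ioc_mem_nhdsLE (hlt k)] with u hu using hx k u hu
  · obtain ⟨k, rfl⟩ : ∃ k, j = k + 1 := ⟨j - 1, by ring⟩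
    rw [hend, ← hz k hj]
    refine ((hX (k + 1)).jump.mono_left (nhdsWithin_mono _ inter_subset_right)).congr' ?_
    refine Filter.Eventually.filter_mono (nhdsWithin_mono _ inter_subset_right) ?_
    filter_upwards [Ioc_mem_nhdsGT (hlt (k + 1))] with u hu using (hx (k + 1) u hu).symm

end Pieces

/-! ### Comparison of solutions of the nonlinear system -/

section Nonlinear

variable {m : ℕ} {A B : Matrix (Fin m) (Fin m) ℝ} {θ : ℤ → ℝ} {f : ℝ → Vec m → Vec m}
  {g : ℝ → Vec m} {h : Vec m → Vec m} {p : ℕ} {ω Mf Mh Mg Lf Lh C γ : ℝ}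

theorem IsSolutionOn.mono {J J' : Set ℝ} {x : ℝ → Vec m} (hx : IsSolutionOn A B f g h θ J x)
    (hJ : J' ⊆ J) : IsSolutionOn A B f g h θ J' x where
  deriv t ht hr := (hx.deriv t (hJ ht) hr).mono hJ
  left_cont k hk := (hx.left_cont k (hJ hk)).mono (inter_subset_inter_left _ hJ)
  jump k hk := (hx.jump k (hJ hk)).mono_left
    (nhdsWithin_mono _ (inter_subset_inter_left _ hJ))

/-- Solutions for two inputs `g`, `g'` that are `ε`-close on `[a, b]` become `O(ε)`-close. -/
theorem HasExponentialEstimate.norm_sub_le_add (hE : HasExponentialEstimate A B θ Lf Lh C γ)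
    (hf_lip : ∀ t x₁ x₂, ‖f t x₁ - f t x₂‖ ≤ Lf * ‖x₁ - x₂‖)
    (hh_lip : ∀ x₁ x₂, ‖h x₁ - h x₂‖ ≤ Lh * ‖x₁ - x₂‖) {g' : ℝ → Vec m} {a b d ε : ℝ}
    {x y : ℝ → Vec m} (hx : IsSolutionOn A B f g h θ (Icc a b) x)
    (hy : IsSolutionOn A B f g' h θ (Icc a b) y) (hd : 0 < d) (hε : 0 ≤ ε)
    (hg : ∀ t ∈ Icc a b, ‖g t - g' t‖ ≤ ε) (hxy : ‖x a - y a‖ ≤ d) {t : ℝ} (ht : t ∈ Icc a b) :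
    ‖x t - y t‖ ≤ C * (d * Real.exp (-γ * (t - a)) + ε) := by
  refine hE a b d ε _ _ _ hd hε (hx.forced.sub hy.forced) (fun t ht _ => ?_) (fun k _ => ?_)
    hxy t ht
  · calc ‖f t (x t) + g t - (f t (y t) + g' t)‖
        = ‖(f t (x t) - f t (y t)) + (g t - g' t)‖ := by congr 1; abel
      _ ≤ ‖f t (x t) - f t (y t)‖ + ‖g t - g' t‖ := norm_add_le _ _
      _ ≤ _ := add_le_add (hf_lip _ _ _) (hg t ht)
  · exact (hh_lip _ _).trans (le_add_of_nonneg_right hε)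

theorem HasExponentialEstimate.norm_sub_le (hE : HasExponentialEstimate A B θ Lf Lh C γ)
    (hf_lip : ∀ t x₁ x₂, ‖f t x₁ - f t x₂‖ ≤ Lf * ‖x₁ - x₂‖)
    (hh_lip : ∀ x₁ x₂, ‖h x₁ - h x₂‖ ≤ Lh * ‖x₁ - x₂‖) {a b d : ℝ}
    {x y : ℝ → Vec m} (hx : IsSolutionOn A B f g h θ (Icc a b) x)
    (hy : IsSolutionOn A B f g h θ (Icc a b) y) (hd : 0 < d) (hxy : ‖x a - y a‖ ≤ d)
    {t : ℝ} (ht : t ∈ Icc a b) :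
    ‖x t - y t‖ ≤ C * (d * Real.exp (-γ * (t - a))) := by
  simpa using hE.norm_sub_le_add hf_lip hh_lip hx hy hd le_rfl (fun t _ => by simp) hxy ht

/-- All solutions are bounded, because the nonlinear terms are. -/
theorem HasExponentialEstimate.norm_le (hE : HasExponentialEstimate A B θ Lf Lh C γ)
    (hC : 0 ≤ C) (hγ : 0 ≤ γ) (hLf : 0 ≤ Lf) (hLh : 0 ≤ Lh)
    (hf_bdd : ∀ t x, ‖f t x‖ ≤ Mf) (hh_bdd : ∀ x, ‖h x‖ ≤ Mh) (hg_bdd : ∀ t, ‖g t‖ ≤ Mg)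
    {a b d : ℝ} {x : ℝ → Vec m} (hx : IsSolutionOn A B f g h θ (Icc a b) x) (hd : 0 < d)
    (hxa : ‖x a‖ ≤ d) {t : ℝ} (ht : t ∈ Icc a b) :
    ‖x t‖ ≤ C * (d + (Mf + Mh + Mg)) := by
  have hMf : 0 ≤ Mf := (norm_nonneg _).trans (hf_bdd 0 0)
  have hMh : 0 ≤ Mh := (norm_nonneg _).trans (hh_bdd 0)
  have hMg : 0 ≤ Mg := (norm_nonneg _).trans (hg_bdd 0)
  refine (hE a b d (Mf + Mh + Mg) _ _ _ hd (by positivity) hx.forced (fun t _ _ => ?_)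
    (fun k _ => ?_) hxa t ht).trans ?_
  · have h1 : 0 ≤ Lf * ‖x t‖ := by positivity
    linarith [norm_add_le (f t (x t)) (g t), hf_bdd t (x t), hg_bdd t]
  · have h1 : 0 ≤ Lh * ‖x (θ k)‖ := by positivity
    linarith [hh_bdd (x (θ k))]
  · have h1 : Real.exp (-γ * (t - a)) ≤ 1 :=
      Real.exp_le_one_iff.2 (by nlinarith [ht.1])
    gcongr
    exact mul_le_of_le_one_right hd.le h1

theorem tendsto_mul_exp_atBot (hγ : 0 < γ) (c t : ℝ) :
    Tendsto (fun a => c * Real.exp (-γ * (t - a))) atBot (𝓝 0) := by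
  have h1 : Tendsto (fun a : ℝ => -γ * (t - a)) atBot atBot := by
    have : Tendsto (fun a : ℝ => γ * a + -γ * t) atBot atBot :=
      tendsto_atBot_add_const_right _ _ (tendsto_id.const_mul_atBot hγ)
    refine this.congr fun a => by ring
  simpa using (Real.tendsto_exp_atBot.comp h1).const_mul c

/-- Two bounded solutions on the whole line coincide. -/
theorem HasExponentialEstimate.eq_of_bounded (hE : HasExponentialEstimate A B θ Lf Lh C γ)
    (hγ : 0 < γ) (hf_lip : ∀ t x₁ x₂, ‖f t x₁ - f t x₂‖ ≤ Lf * ‖x₁ - x₂‖)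
    (hh_lip : ∀ x₁ x₂, ‖h x₁ - h x₂‖ ≤ Lh * ‖x₁ - x₂‖) {x y : ℝ → Vec m}
    (hx : IsSolutionOn A B f g h θ univ x) (hy : IsSolutionOn A B f g h θ univ y)
    {R S : ℝ} (hxb : ∀ t, ‖x t‖ ≤ R) (hyb : ∀ t, ‖y t‖ ≤ S) : x = y := by
  funext t
  have hR : 0 ≤ R := (norm_nonneg _).trans (hxb 0)
  have hS : 0 ≤ S := (norm_nonneg _).trans (hyb 0)
  have h1 : ∀ᶠ a in atBot, ‖x t - y t‖ ≤ C * (R + S + 1) * Real.exp (-γ * (t - a)) := by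
    filter_upwards [eventually_le_atBot t] with a ha
    rw [mul_assoc]
    refine hE.norm_sub_le hf_lip hh_lip (hx.mono (subset_univ (Icc a t)))
      (hy.mono (subset_univ _)) (by linarith) ?_ ⟨ha, le_rfl⟩
    linarith [_root_.norm_sub_le (x a) (y a), hxb a, hyb a]
  have h2 := ge_of_tendsto (tendsto_mul_exp_atBot hγ _ t) h1
  exact sub_eq_zero.1 (norm_le_zero_iff.1 h2)

theorem HasExponentialEstimate.asymptoticallyStable
    (hE : HasExponentialEstimate A B θ Lf Lh C γ) (hC : 0 < C) (hγ : 0 < γ)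
    (hf_lip : ∀ t x₁ x₂, ‖f t x₁ - f t x₂‖ ≤ Lf * ‖x₁ - x₂‖)
    (hh_lip : ∀ x₁ x₂, ‖h x₁ - h x₂‖ ≤ Lh * ‖x₁ - x₂‖) {φ : ℝ → Vec m}
    (hφ : IsSolutionOn A B f g h θ univ φ) : AsymptoticallyStable A B f g h θ φ := by
  intro t₀
  have key : ∀ d > 0, ∀ x, IsSolutionOn A B f g h θ (Ici t₀) x → ‖x t₀ - φ t₀‖ < d →
      ∀ t ≥ t₀, ‖x t - φ t‖ ≤ C * (d * Real.exp (-γ * (t - t₀))) := fun d hd x hx hxd t ht =>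
    hE.norm_sub_le hf_lip hh_lip (hx.mono Icc_subset_Ici_self)
      (hφ.mono (subset_univ (Icc t₀ t))) hd hxd.le ⟨ht, le_rfl⟩
  refine ⟨fun ε hε => ⟨ε / (2 * C), by positivity, fun x hx hxd t ht => ?_⟩,
    1, one_pos, fun x hx hxd => ?_⟩
  · refine (key _ (by positivity) x hx hxd t ht).trans_lt ?_
    have h1 : Real.exp (-γ * (t - t₀)) ≤ 1 := Real.exp_le_one_iff.2 (by nlinarith)
    calc C * (ε / (2 * C) * Real.exp (-γ * (t - t₀))) ≤ C * (ε / (2 * C) * 1) := by gcongr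
      _ = ε / 2 := by field_simp
      _ < ε := half_lt_self hε
  · have h1 : Tendsto (fun t : ℝ => -γ * (t - t₀)) atTop atBot :=
      (tendsto_atTop_add_const_right _ _ tendsto_id).const_mul_atTop_of_neg (neg_lt_zero.2 hγ)
    have h2 : Tendsto (fun t => C * (1 * Real.exp (-γ * (t - t₀)))) atTop (𝓝 0) := by
      simpa using (Real.tendsto_exp_atBot.comp h1).const_mul C
    refine squeeze_zero' (Eventually.of_forall fun t => norm_nonneg _) ?_ h2
    filter_upwards [eventually_ge_atTop t₀] with t ht using key 1 one_pos x hx hxd t ht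

/-! ### The bounded solution on the whole line -/

/-- The bounded solution is the limit of the solutions that start at `θ_s` with the value `0`, as
`s → -∞`.  Only its values `z_k` at the impulse moments are obtained as limits; between the moments
it is the trajectory through `z_k`, which depends continuously on `z_k`. -/
theorem exists_bounded_solution (hθ : RegularMoments θ p ω)
    (hE : HasExponentialEstimate A B θ Lf Lh C γ) (hC : 0 < C) (hγ : 0 < γ)
    (hLf : 0 ≤ Lf) (hLh : 0 ≤ Lh) (hf : Continuous (Function.uncurry f))
    (hf_bdd : ∀ t x, ‖f t x‖ ≤ Mf) (hh_bdd : ∀ x, ‖h x‖ ≤ Mh) (hg_bdd : ∀ t, ‖g t‖ ≤ Mg)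
    (hf_lip : ∀ t x₁ x₂, ‖f t x₁ - f t x₂‖ ≤ Lf * ‖x₁ - x₂‖)
    (hh_lip : ∀ x₁ x₂, ‖h x₁ - h x₂‖ ≤ Lh * ‖x₁ - x₂‖)
    (hg : ∀ k : ℤ, ∃ v, ∀ t ∈ Ioc (θ k) (θ (k + 1)), g t = v) :
    ∃ φ : ℝ → Vec m, IsSolutionOn A B f g h θ univ φ ∧ ∃ R, ∀ t, ‖φ t‖ ≤ R := by
  have hmono := hθ.strictMono
  have hMf : 0 ≤ Mf := (norm_nonneg _).trans (hf_bdd 0 0)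
  have hMh : 0 ≤ Mh := (norm_nonneg _).trans (hh_bdd 0)
  have hMg : 0 ≤ Mg := (norm_nonneg _).trans (hg_bdd 0)
  have hle : ∀ k, θ k ≤ θ (k + 1) := fun k => hmono.monotone (by omega)
  have hex : ∀ k z, ∃ X : ℝ → Vec m, IsPieceSolution A B f g h θ k z X := fun k z => by
    obtain ⟨v, hv⟩ := hg k
    exact exists_isPieceSolution A B h hmono hf hf_bdd hLf hf_lip hv z
  choose X hX using hex
  have hXsol := fun k z => (hX k z).isSolutionOn hmono
  choose κ hκ using hθ.exists_mem_Ioc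
  have hκ_eq : ∀ k, ∀ t ∈ Ioc (θ k) (θ (k + 1)), κ t = k := fun k t ht => by
    have h1 := hmono.lt_iff_lt.1 ((hκ t).1.trans_le ht.2)
    have h2 := hmono.lt_iff_lt.1 (ht.1.trans_le (hκ t).2)
    omega
  have hglue : ∀ (z : ℤ → Vec m) (k) (t), t ∈ Ioc (θ k) (θ (k + 1)) →
      X (κ t) (z (κ t)) t = X k (z k) t := fun z k t ht => by rw [hκ_eq k t ht]
  have hXlip : ∀ k z z', ‖X k z (θ (k + 1)) - X k z' (θ (k + 1))‖ ≤ C * ‖z - z'‖ := by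
    intro k z z'
    rcases eq_or_ne z z' with rfl | hne
    · simp
    · refine (hE.norm_sub_le hf_lip hh_lip (hXsol k z) (hXsol k z')
        (norm_pos_iff.2 (sub_ne_zero.2 hne)) (by rw [(hX k z).initial, (hX k z').initial])
        ⟨hle k, le_rfl⟩).trans ?_
      gcongr
      exact mul_le_of_le_one_right (norm_nonneg _)
        (Real.exp_le_one_iff.2 (by nlinarith [hle k]))
  have horb : ∀ s : ℤ, ∃ z : ℤ → Vec m, z s = 0 ∧
      ∀ k, s ≤ k → z (k + 1) = X k (z k) (θ (k + 1)) := by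
    intro s
    let o : ℕ → Vec m := fun n => Nat.rec 0 (fun i v => X (s + i) v (θ (s + i + 1))) n
    refine ⟨fun k => o (k - s).toNat, by simp [o], fun k hk => ?_⟩
    obtain ⟨n, rfl⟩ := Int.le.dest hk
    have e1 : (s + (n : ℤ) + 1 - s).toNat = n + 1 := by omega
    have e2 : (s + (n : ℤ) - s).toNat = n := by omega
    simp only [e1, e2]
    rfl
  choose z hz0 hz using horb
  set x : ℤ → ℝ → Vec m := fun s t => X (κ t) (z s (κ t)) t with hx
  have hxz : ∀ s k, s < k → x s (θ k) = z s k := fun s k hk => by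
    have h1 : θ k ∈ Ioc (θ (k - 1)) (θ (k - 1 + 1)) :=
      ⟨hmono (by omega), by rw [sub_add_cancel]⟩
    have h2 := hz s (k - 1) (by omega)
    rw [sub_add_cancel] at h2
    rw [h2]
    exact hglue (z s) (k - 1) _ h1
  have hxsol : ∀ s, IsSolutionOn A B f g h θ (Ici (θ (s + 1))) (x s) := fun s =>
    isSolutionOn_of_pieces hθ (fun k => hX k (z s k)) (hglue (z s)) fun k hk =>
      hz s k (by have := hmono.le_iff_le.1 hk; omega)
  set R₀ := C * (1 + (Mf + Mh + Mg)) with hR₀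
  have hR₀0 : 0 < R₀ := by positivity
  have hz1 : ∀ s, ‖z s (s + 1)‖ ≤ R₀ := fun s => by
    rw [hz s s le_rfl]
    refine hE.norm_le hC.le hγ.le hLf hLh hf_bdd hh_bdd hg_bdd (hXsol s (z s s)) one_pos ?_
      ⟨hle s, le_rfl⟩
    rw [(hX s _).initial, hz0]
    simp
  set R := C * (R₀ + (Mf + Mh + Mg)) with hR
  have hR0 : 0 < R := by positivity
  have hzb : ∀ s k, s < k → ‖z s k‖ ≤ R := fun s k hk => by
    rw [← hxz s k hk]
    refine hE.norm_le hC.le hγ.le hLf hLh hf_bdd hh_bdd hg_bdd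
      ((hxsol s).mono Icc_subset_Ici_self) hR₀0 ?_
      ⟨hmono.monotone (by omega : s + 1 ≤ k), le_rfl⟩
    rw [hxz s _ (by omega)]
    exact hz1 s
  have hdiff : ∀ s s' k, s' ≤ s → s < k →
      ‖z s' k - z s k‖ ≤ C * (2 * R) * Real.exp (-γ * (θ k - θ (s + 1))) := by
    intro s s' k hs hk
    rw [← hxz s k hk, ← hxz s' k (by omega), mul_assoc]
    refine hE.norm_sub_le hf_lip hh_lip ((hxsol s').mono ?_)
      ((hxsol s).mono Icc_subset_Ici_self) (by positivity) ?_
      ⟨hmono.monotone (by omega : s + 1 ≤ k), le_rfl⟩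
    · exact Icc_subset_Ici_self.trans (Ici_subset_Ici.2 (hmono.monotone (by omega)))
    · rw [hxz s _ (by omega), hxz s' _ (by omega)]
      linarith [_root_.norm_sub_le (z s' (s + 1)) (z s (s + 1)), hzb s (s + 1) (by omega),
        hzb s' (s + 1) (by omega)]
  have hθbot : Tendsto (fun n : ℕ => θ (-n + 1)) atTop atBot := by
    have h1 : Tendsto θ atBot atBot := tendsto_atBot_atBot_of_monotone hmono.monotone fun t => by
      obtain ⟨k, hk⟩ := hθ.exists_lt t
      exact ⟨k, hk.le⟩
    refine h1.comp (tendsto_atBot_add_const_right _ _ ?_)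
    exact tendsto_neg_atTop_atBot.comp tendsto_natCast_atTop_atTop
  have hlim : ∀ k, ∃ Z : Vec m, Tendsto (fun n : ℕ => z (-n) k) atTop (𝓝 Z) := by
    intro k
    refine cauchySeq_tendsto_of_complete (Metric.cauchySeq_iff'.2 fun ε hε => ?_)
    have h1 : Tendsto (fun n : ℕ => C * (2 * R) * Real.exp (-γ * (θ k - θ (-n + 1)))) atTop
        (𝓝 0) := (tendsto_mul_exp_atBot hγ _ _).comp hθbot
    obtain ⟨N, hN, hNk⟩ := ((h1.eventually (gt_mem_nhds hε)).and
      (eventually_gt_atTop (-k).toNat)).exists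
    refine ⟨N, fun n hn => ?_⟩
    rw [dist_eq_norm]
    exact (hdiff (-N) (-n) k (by omega) (by omega)).trans_lt hN
  choose Z hZ using hlim
  have hZb : ∀ k, ‖Z k‖ ≤ R := fun k => le_of_tendsto (hZ k).norm (by
    filter_upwards [eventually_gt_atTop (-k).toNat] with n hn
    exact hzb _ _ (by omega))
  have hZs : ∀ k, Z (k + 1) = X k (Z k) (θ (k + 1)) := by
    intro k
    have h1 : Tendsto (fun n : ℕ => X k (z (-n) k) (θ (k + 1))) atTop
        (𝓝 (X k (Z k) (θ (k + 1)))) := by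
      rw [tendsto_iff_norm_sub_tendsto_zero]
      refine squeeze_zero (fun n => norm_nonneg _) (fun n => hXlip k _ _) ?_
      simpa using (tendsto_iff_norm_sub_tendsto_zero.1 (hZ k)).const_mul C
    refine tendsto_nhds_unique (hZ (k + 1)) (h1.congr' ?_)
    filter_upwards [eventually_gt_atTop (-k).toNat] with n hn
    exact (hz _ _ (by omega)).symm
  refine ⟨fun t => X (κ t) (Z (κ t)) t,
    isSolutionOn_of_pieces hθ (fun k => hX k (Z k)) (hglue Z) fun k _ => hZs k,
    C * (R + (Mf + Mh + Mg)), fun t => ?_⟩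
  refine hE.norm_le hC.le hγ.le hLf hLh hf_bdd hh_bdd hg_bdd (hXsol (κ t) (Z (κ t))) hR0 ?_
    (Ioc_subset_Icc_self (hκ t))
  rw [(hX _ _).initial]
  exact hZb _

end Nonlinear

/-! ### Periodicity and the piecewise constant input -/

section Unpredictable

variable {m : ℕ} {A B : Matrix (Fin m) (Fin m) ℝ} {θ : ℤ → ℝ} {f : ℝ → Vec m → Vec m}
  {g : ℝ → Vec m} {h : Vec m → Vec m} {σ : ℤ → Vec m} {p : ℕ} {ω Mf Mh Mg Lf Lh C γ R Λ : ℝ}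

theorem RegularMoments.mem_Ioc_shift (hθ : RegularMoments θ p ω) (n : ℕ) {k : ℤ} {t : ℝ}
    (ht : t ∈ Ioc (θ k) (θ (k + 1))) :
    t + ω * n ∈ Ioc (θ (k + n * p)) (θ (k + n * p + 1)) := by
  have e : k + n * p + 1 = (k + 1) + n * p := by ring
  rw [e, hθ.shift_mul, hθ.shift_mul]
  constructor <;> linarith [ht.1, ht.2]

theorem RegularMoments.shift_mem_range (hθ : RegularMoments θ p ω) (n : ℕ) {t : ℝ}
    (ht : t + ω * n ∈ range θ) : t ∈ range θ := by
  obtain ⟨k, hk⟩ := ht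
  refine ⟨k - n * p, ?_⟩
  have := hθ.shift_mul n (k - n * p)
  rw [sub_add_cancel] at this
  linarith

/-- A shift of a solution by a multiple of the period solves the system with shifted input. -/
theorem IsSolutionOn.shift (hθ : RegularMoments θ p ω) (hf_per : ∀ t x, f (t + ω) x = f t x)
    {φ : ℝ → Vec m} (hφ : IsSolutionOn A B f g h θ univ φ) (n : ℕ) :
    IsSolutionOn A B f (fun t => g (t + ω * n)) h θ univ (fun t => φ (t + ω * n)) := by
  have hper : ∀ t x, f (t + ω * n) x = f t x := fun t x => by
    have : Function.Periodic (fun t => f t x) ω := fun t => hf_per t x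
    rw [mul_comm]
    exact this.nat_mul n t
  have hsh : ∀ k : ℤ, θ k + ω * n = θ (k + n * p) := fun k => by rw [hθ.shift_mul]; ring
  have hcont : ∀ t, Tendsto (fun t => t + ω * n) (𝓝 t) (𝓝 (t + ω * n)) := fun t =>
    (continuous_add_const (ω * (n : ℝ))).tendsto t
  refine ⟨fun t _ hr => ?_, fun k _ => ?_, fun k _ => ?_⟩
  · have h1 := hφ.deriv (t + ω * n) (mem_univ _) fun hr' => hr (hθ.shift_mem_range n hr')
    rw [hasDerivWithinAt_univ] at h1 ⊢
    rw [hper] at h1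
    exact h1.comp_add_const t _
  · have h1 := hφ.left_cont (k + n * p) (mem_univ _)
    rw [← hsh, univ_inter] at h1
    rw [univ_inter]
    exact Tendsto.comp h1 (tendsto_nhdsWithin_iff.2
      ⟨(hcont _).mono_left nhdsWithin_le_nhds, by
        filter_upwards [self_mem_nhdsWithin] with u hu
        exact add_le_add_left (mem_Iic.1 hu) _⟩)
  · have h1 := hφ.jump (k + n * p) (mem_univ _)
    rw [← hsh, univ_inter] at h1
    rw [univ_inter]
    exact Tendsto.comp h1 (tendsto_nhdsWithin_iff.2
      ⟨(hcont _).mono_left nhdsWithin_le_nhds, by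
        filter_upwards [self_mem_nhdsWithin] with u hu
        exact add_lt_add_left (mem_Ioi.1 hu) _⟩)

theorem eq_of_mem_Ioc_moments (hθ : RegularMoments θ p ω)
    (hg : ∀ k : ℤ, ∀ t ∈ Ioc (θ (k * p)) (θ ((k + 1) * p)), g t = σ k) {k : ℤ} {t : ℝ}
    (ht : t ∈ Ioc (θ k) (θ (k + 1))) : g t = σ (k / p) := by
  have hp : (0 : ℤ) < p := by exact_mod_cast hθ.pos
  refine hg _ t ⟨lt_of_le_of_lt (hθ.strictMono.monotone ?_) ht.1,
    ht.2.trans (hθ.strictMono.monotone ?_)⟩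
  · exact Int.ediv_mul_le k hp.ne'
  · exact Int.lt_ediv_add_one_mul_self k hp

theorem shift_eq_of_mem_Ioc_moments (hθ : RegularMoments θ p ω)
    (hg : ∀ k : ℤ, ∀ t ∈ Ioc (θ (k * p)) (θ ((k + 1) * p)), g t = σ k) {k : ℤ} {t : ℝ}
    (ht : t ∈ Ioc (θ k) (θ (k + 1))) (n : ℕ) : g (t + ω * n) = σ (k / p + n) := by
  have hp : (p : ℤ) ≠ 0 := by exact_mod_cast hθ.pos.ne'
  rw [eq_of_mem_Ioc_moments hθ hg (hθ.mem_Ioc_shift n ht), Int.add_mul_ediv_right _ _ hp]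

/-! ### Unpredictability of the bounded solution -/

theorem IsForcedSolutionOn.norm_sub_le_of_piece (hθ : StrictMono θ) {F : ℝ → Vec m}
    {H : ℤ → Vec m} {w : ℝ → Vec m} (hw : IsForcedSolutionOn A B θ F H univ w)
    (hΛ : ∀ t, ‖mulE A (w t) + F t‖ ≤ Λ) {k : ℤ} {s r : ℝ}
    (hs : s ∈ Ioc (θ k) (θ (k + 1))) (hr : r ∈ Ioc (θ k) (θ (k + 1))) :
    ‖w s - w r‖ ≤ Λ * |s - r| := by
  have key : ∀ s ∈ Ioc (θ k) (θ (k + 1)), ∀ r ∈ Ioc (θ k) (θ (k + 1)), s ≤ r →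
      ‖w r - w s‖ ≤ Λ * (r - s) := fun s hs r hr hsr =>
    norm_image_sub_le_of_norm_deriv_right_le_segment
      (hw.continuousOn hθ (subset_univ _) hs.1 hr.2)
      (fun t ht => hw.hasDerivWithinAt_Ici hθ (subset_univ _) hs.1 hr.2 ht)
      (fun t _ => hΛ t) r ⟨hsr, le_rfl⟩
  rcases le_total s r with hsr | hsr
  · rw [norm_sub_rev, abs_of_nonpos (sub_nonpos.2 hsr), neg_sub]
    exact key s hs r hr hsr
  · rw [abs_of_nonneg (sub_nonneg.2 hsr)]
    exact key r hr s hs hsr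

/-- A constant input of size `δ` cannot be balanced by a small `w`: if `‖w‖ < e` on all of
`[s, r]`, then `w` could not grow by about `(r - s)δ` as the equation prescribes. -/
theorem IsForcedSolutionOn.exists_le_norm (hθ : StrictMono θ) {F : ℝ → Vec m}
    {H : ℤ → Vec m} {w : ℝ → Vec m} (hw : IsForcedSolutionOn A B θ F H univ w) {k : ℤ}
    {s r δ e : ℝ} {c : Vec m} (hs : θ k < s) (hr : r ≤ θ (k + 1)) (hsr : s < r) (hLf : 0 ≤ Lf)
    (hF : ∀ t ∈ Icc s r, ‖F t - c‖ ≤ Lf * ‖w t‖) (hc : δ ≤ ‖c‖)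
    (he : e * (2 + (‖A‖ + Lf) * (r - s)) ≤ δ * (r - s)) :
    ∃ t ∈ Icc s r, e ≤ ‖w t‖ := by
  by_contra! hlt
  have h1 : ∀ x ∈ Icc s r, ‖(w x - x • c) - (w s - s • c)‖ ≤ (‖A‖ + Lf) * e * (x - s) := by
    refine norm_image_sub_le_of_norm_deriv_right_le_segment
      (f' := fun t => mulE A (w t) + F t - (1 : ℝ) • c)
      ((hw.continuousOn hθ (subset_univ _) hs hr).sub (by fun_prop))
      (fun t ht => (hw.hasDerivWithinAt_Ici hθ (subset_univ _) hs hr ht).sub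
        ((hasDerivWithinAt_id t _).smul_const c)) fun t ht => ?_
    have ht' : t ∈ Icc s r := Ico_subset_Icc_self ht
    calc ‖mulE A (w t) + F t - (1 : ℝ) • c‖ = ‖mulE A (w t) + (F t - c)‖ := by
          rw [one_smul, add_sub_assoc]
      _ ≤ ‖A‖ * ‖w t‖ + Lf * ‖w t‖ :=
          (norm_add_le _ _).trans (add_le_add (norm_mulE_le _ _) (hF t ht'))
      _ = (‖A‖ + Lf) * ‖w t‖ := by ring
      _ ≤ (‖A‖ + Lf) * e := by gcongr; exact (hlt t ht').le
  have h2 := h1 r ⟨hsr.le, le_rfl⟩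
  have h3 : (r - s) * δ ≤ ‖(r - s) • c‖ := by
    rw [norm_smul, Real.norm_of_nonneg (sub_nonneg.2 hsr.le)]
    exact mul_le_mul_of_nonneg_left hc (sub_nonneg.2 hsr.le)
  have h4 : (r - s) • c = w r - w s - ((w r - r • c) - (w s - s • c)) := by
    rw [sub_smul]; abel
  have h5 := norm_sub_le (w r - w s) ((w r - r • c) - (w s - s • c))
  rw [← h4] at h5
  have h6 := norm_sub_le (w r) (w s)
  have h7 := hlt r ⟨hsr.le, le_rfl⟩
  have h8 := hlt s ⟨le_rfl, hsr.le⟩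
  nlinarith

/-- The shifts by `ω ζ_n` converge to the bounded solution, since they solve the system with inputs
that converge on compact sets, and the influence of the distant past decays exponentially. -/
theorem tendstoUniformlyOn_shift (hθ : RegularMoments θ p ω)
    (hE : HasExponentialEstimate A B θ Lf Lh C γ) (hC : 0 < C) (hγ : 0 < γ)
    (hf_per : ∀ t x, f (t + ω) x = f t x)
    (hf_lip : ∀ t x₁ x₂, ‖f t x₁ - f t x₂‖ ≤ Lf * ‖x₁ - x₂‖)
    (hh_lip : ∀ x₁ x₂, ‖h x₁ - h x₂‖ ≤ Lh * ‖x₁ - x₂‖)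
    (hg : ∀ k : ℤ, ∀ t ∈ Ioc (θ (k * p)) (θ ((k + 1) * p)), g t = σ k)
    {φ : ℝ → Vec m} (hφ : IsSolutionOn A B f g h θ univ φ) (hφb : ∀ t, ‖φ t‖ ≤ R) {ζ : ℕ → ℕ}
    (hrec : ∀ k : ℤ, Tendsto (fun n => ‖σ (k + ζ n) - σ k‖) atTop (𝓝 0))
    {K : Set ℝ} (hK : IsCompact K) :
    TendstoUniformlyOn (fun n t => φ (t + ω * ζ n)) φ atTop K := by
  have hR : 0 ≤ R := (norm_nonneg _).trans (hφb 0)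
  obtain ⟨c, hc⟩ := hK.bddBelow
  obtain ⟨b, hb⟩ := hK.bddAbove
  refine Metric.tendstoUniformlyOn_iff.2 fun ε hε => ?_
  have h0 : Tendsto (fun a => C * (2 * R + 1) * Real.exp (-γ * (c - a))) atBot (𝓝 0) :=
    tendsto_mul_exp_atBot hγ _ _
  obtain ⟨a, ha, hac⟩ := ((h0.eventually (gt_mem_nhds (half_pos hε))).and
    (eventually_le_atBot c)).exists
  set e := ε / (2 * C) with he
  have he0 : 0 < e := by positivity
  obtain ⟨k₀, hk₀⟩ := hθ.exists_lt a
  obtain ⟨k₁, hk₁⟩ := hθ.exists_ge b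
  have hev : ∀ᶠ n in atTop, ∀ k ∈ Icc k₀ k₁, ‖σ (k / p + ζ n) - σ (k / p)‖ < e :=
    (Filter.eventually_all_finite (finite_Icc k₀ k₁)).2 fun k _ =>
      (hrec (k / p)).eventually (gt_mem_nhds he0)
  filter_upwards [hev] with n hn t ht
  have hta : t ∈ Icc a b := ⟨hac.trans (hc ht), hb ht⟩
  rw [dist_comm, dist_eq_norm]
  have h1 := hE.norm_sub_le_add hf_lip hh_lip (d := 2 * R + 1) (ε := e)
    ((hφ.shift hθ hf_per (ζ n)).mono (subset_univ (Icc a b))) (hφ.mono (subset_univ _))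
    (by linarith) he0.le (fun s hs => ?_)
    (by linarith [norm_sub_le (φ (a + ω * ζ n)) (φ a), hφb (a + ω * ζ n), hφb a]) hta
  · have h2 : Real.exp (-γ * (t - a)) ≤ Real.exp (-γ * (c - a)) :=
      Real.exp_le_exp.2 (by nlinarith [hc ht])
    calc _ ≤ C * ((2 * R + 1) * Real.exp (-γ * (t - a)) + e) := h1
      _ ≤ C * ((2 * R + 1) * Real.exp (-γ * (c - a)) + e) := by gcongr
      _ = C * (2 * R + 1) * Real.exp (-γ * (c - a)) + ε / 2 := by rw [he]; field_simp
      _ < ε := by linarith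
  · obtain ⟨k, hk⟩ := hθ.exists_mem_Ioc s
    rw [shift_eq_of_mem_Ioc_moments hθ hg hk, eq_of_mem_Ioc_moments hθ hg hk]
    refine (hn k ⟨?_, ?_⟩).le
    · have := hθ.strictMono.lt_iff_lt.1 (hk₀.trans_le (hs.1.trans hk.2))
      omega
    · exact (hθ.strictMono.lt_iff_lt.1 (hk.1.trans_le (hs.2.trans hk₁))).le

/-- The separation property: on `(θ_{η_n p}, θ_{η_n p + 1}]`, an interval whose length does not
depend on `n`, the inputs of the shifted and of the original solution differ by a constant vector
of norm at least `δ₀`. -/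
theorem exists_separated_shift (hθ : RegularMoments θ p ω) (hLf : 0 ≤ Lf)
    (hf_per : ∀ t x, f (t + ω) x = f t x)
    (hf_lip : ∀ t x₁ x₂, ‖f t x₁ - f t x₂‖ ≤ Lf * ‖x₁ - x₂‖)
    (hg : ∀ k : ℤ, ∀ t ∈ Ioc (θ (k * p)) (θ ((k + 1) * p)), g t = σ k)
    {φ : ℝ → Vec m} (hφ : IsSolutionOn A B f g h θ univ φ) (hΛ : 0 ≤ Λ)
    (hφΛ : ∀ k, ∀ s ∈ Ioc (θ k) (θ (k + 1)), ∀ r ∈ Ioc (θ k) (θ (k + 1)),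
      ‖φ s - φ r‖ ≤ Λ * |s - r|)
    {ζ η : ℕ → ℕ} {δ₀ : ℝ} (hδ₀ : 0 < δ₀) (hη : Tendsto η atTop atTop)
    (hsep : ∀ n, δ₀ ≤ ‖σ (ζ n + η n) - σ (η n)‖) :
    ∃ ε₀ > (0 : ℝ), ∃ r > (0 : ℝ), ∃ τ : ℕ → ℝ, Tendsto τ atTop atTop ∧
      ∀ n, ∀ t ∈ Icc (τ n - r) (τ n + r), ε₀ ≤ ‖φ (t + ω * ζ n) - φ t‖ := by
  have hp : (p : ℤ) ≠ 0 := by exact_mod_cast hθ.pos.ne'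
  set l := θ 1 - θ 0 with hl
  have hl0 : 0 < l := sub_pos.2 (hθ.strictMono (by norm_num))
  have hA : 0 ≤ ‖A‖ := norm_nonneg A
  set e := δ₀ * (l / 2) / (2 + (‖A‖ + Lf) * (l / 2)) with he
  have he0 : 0 < e := by positivity
  have hstart : ∀ n, θ ((η n : ℤ) * p) = θ 0 + η n * ω := fun n => by
    have := hθ.shift_mul (η n) 0
    rwa [zero_add] at this
  have hend : ∀ n, θ ((η n : ℤ) * p + 1) = θ 0 + η n * ω + l := fun n => by
    have := hθ.shift_mul (η n) 1
    rw [add_comm, this, hl]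
    ring
  have hex : ∀ n, ∃ t ∈ Icc (θ 0 + η n * ω + l / 4) (θ 0 + η n * ω + l / 4 + l / 2),
      e ≤ ‖φ (t + ω * ζ n) - φ t‖ := by
    intro n
    refine ((hφ.shift hθ hf_per (ζ n)).forced.sub hφ.forced).exists_le_norm hθ.strictMono
      (k := (η n : ℤ) * p) (c := σ (ζ n + η n) - σ (η n)) (Lf := Lf)
      (by rw [hstart]; linarith) (by rw [hend]; linarith) (by linarith) hLf (fun t ht => ?_)
      (hsep n) ?_
    · have hk : t ∈ Ioc (θ ((η n : ℤ) * p)) (θ ((η n : ℤ) * p + 1)) := by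
        rw [hstart, hend]
        constructor <;> linarith [ht.1, ht.2]
      have e1 : g (t + ω * ζ n) = σ (ζ n + η n) := by
        rw [shift_eq_of_mem_Ioc_moments hθ hg hk, Int.mul_ediv_cancel _ hp, add_comm]
      have e2 : g t = σ (η n) := by
        rw [eq_of_mem_Ioc_moments hθ hg hk, Int.mul_ediv_cancel _ hp]
      rw [e1, e2]
      refine le_of_eq_of_le ?_ (hf_lip t _ _)
      congr 1
      abel
    · rw [add_sub_cancel_left, he, div_mul_cancel₀ _ (by positivity)]
  choose τ hτ hτe using hex
  refine ⟨e / 2, half_pos he0, min (l / 8) (e / (4 * (Λ + 1))), by positivity, τ, ?_,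
    fun n t ht => ?_⟩
  · have h1 : Tendsto (fun n => (η n : ℝ) * ω + θ 0) atTop atTop :=
      tendsto_atTop_add_const_right _ _
        ((tendsto_natCast_atTop_atTop.comp hη).atTop_mul_const hθ.period_pos)
    refine tendsto_atTop_mono (fun n => ?_) h1
    linarith [(hτ n).1]
  · have hr1 := min_le_left (l / 8) (e / (4 * (Λ + 1)))
    have hr2 := min_le_right (l / 8) (e / (4 * (Λ + 1)))
    have hmem : ∀ s, |s - τ n| ≤ l / 8 →
        s ∈ Ioc (θ ((η n : ℤ) * p)) (θ ((η n : ℤ) * p + 1)) := fun s hs => by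
      rw [abs_le] at hs
      rw [hstart, hend]
      constructor <;> linarith [(hτ n).1, (hτ n).2]
    have htτ : |t - τ n| ≤ min (l / 8) (e / (4 * (Λ + 1))) := by
      rw [abs_le]
      constructor <;> linarith [ht.1, ht.2]
    have h1 := hmem t (htτ.trans hr1)
    have h2 := hmem (τ n) (by rw [sub_self, abs_zero]; positivity)
    have h3 := hφΛ _ t h1 _ h2
    have h4 := hφΛ _ _ (hθ.mem_Ioc_shift (ζ n) h1) _ (hθ.mem_Ioc_shift (ζ n) h2)
    rw [add_sub_add_right_eq_sub] at h4
    have h5 : Λ * |t - τ n| ≤ e / 4 := by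
      calc Λ * |t - τ n| ≤ (Λ + 1) * (e / (4 * (Λ + 1))) := by
            gcongr
            · linarith
            · exact htτ.trans hr2
        _ = e / 4 := by field_simp
    have h6 : φ (τ n + ω * ζ n) - φ (τ n) = (φ (t + ω * ζ n) - φ t)
        - ((φ (t + ω * ζ n) - φ (τ n + ω * ζ n)) - (φ t - φ (τ n))) := by abel
    have h7 := hτe n
    rw [h6] at h7
    have h8 := norm_sub_le (φ (t + ω * ζ n) - φ t)
      ((φ (t + ω * ζ n) - φ (τ n + ω * ζ n)) - (φ t - φ (τ n)))
    have h9 := norm_sub_le (φ (t + ω * ζ n) - φ (τ n + ω * ζ n)) (φ t - φ (τ n))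
    linarith

theorem UnpredictableSeqWith.unpredictableFunWith (hθ : RegularMoments θ p ω)
    (hE : HasExponentialEstimate A B θ Lf Lh C γ) (hC : 0 < C) (hγ : 0 < γ) (hLf : 0 ≤ Lf)
    (hf_per : ∀ t x, f (t + ω) x = f t x) (hf_bdd : ∀ t x, ‖f t x‖ ≤ Mf)
    (hg_bdd : ∀ t, ‖g t‖ ≤ Mg)
    (hf_lip : ∀ t x₁ x₂, ‖f t x₁ - f t x₂‖ ≤ Lf * ‖x₁ - x₂‖)
    (hh_lip : ∀ x₁ x₂, ‖h x₁ - h x₂‖ ≤ Lh * ‖x₁ - x₂‖)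
    (hg : ∀ k : ℤ, ∀ t ∈ Ioc (θ (k * p)) (θ ((k + 1) * p)), g t = σ k)
    {φ : ℝ → Vec m} (hφ : IsSolutionOn A B f g h θ univ φ) (hφb : ∀ t, ‖φ t‖ ≤ R) {ζ : ℕ → ℕ}
    (hσ : UnpredictableSeqWith σ ζ) : UnpredictableFunWith θ φ (fun n => ω * ζ n) := by
  have hMf : 0 ≤ Mf := (norm_nonneg _).trans (hf_bdd 0 0)
  have hMg : 0 ≤ Mg := (norm_nonneg _).trans (hg_bdd 0)
  have hR : 0 ≤ R := (norm_nonneg _).trans (hφb 0)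
  set Λ := ‖A‖ * R + (Mf + Mg) with hΛ
  have hΛ0 : 0 ≤ Λ := by positivity
  have hφΛ : ∀ k, ∀ s ∈ Ioc (θ k) (θ (k + 1)), ∀ r ∈ Ioc (θ k) (θ (k + 1)),
      ‖φ s - φ r‖ ≤ Λ * |s - r| := fun k s hs r hr =>
    hφ.forced.norm_sub_le_of_piece hθ.strictMono (fun t => (norm_add_le _ _).trans
      (add_le_add ((norm_mulE_le _ _).trans (by gcongr; exact hφb t))
        ((norm_add_le _ _).trans (add_le_add (hf_bdd _ _) (hg_bdd _))))) hs hr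
  refine ⟨⟨R, hφb⟩, fun t ht => ?_, fun k => ?_, fun k => ?_, fun ε hε => ?_, ?_,
    fun K hK => tendstoUniformlyOn_shift hθ hE hC hγ hf_per hf_lip hh_lip hg hφ hφb
      hσ.recurrent hK, ?_⟩
  · exact (hasDerivWithinAt_univ.1 (hφ.deriv t (mem_univ t) ht)).continuousAt
  · have h1 := hφ.left_cont k (mem_univ _)
    rw [univ_inter] at h1
    exact h1.mono Iio_subset_Iic_self
  · have h1 := hφ.jump k (mem_univ _)
    rw [univ_inter] at h1
    exact ⟨_, h1⟩
  · refine ⟨ε / (Λ + 1), by positivity, fun k s hs r hr hsr => ?_⟩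
    rw [lt_div_iff₀ (by positivity)] at hsr
    have := hφΛ k s hs r hr
    nlinarith [abs_nonneg (s - r)]
  · exact (tendsto_natCast_atTop_atTop.comp hσ.shift_tendsto).const_mul_atTop hθ.period_pos
  · obtain ⟨δ₀, hδ₀, η, _, hη, hsep⟩ := hσ.separated
    exact exists_separated_shift hθ hLf hf_per hf_lip hg hφ hΛ0 hφΛ hδ₀ hη hsep

end Unpredictable

theorem theorem3p1 {m : ℕ} (A B : Matrix (Fin m) (Fin m) ℝ)
    (f : ℝ → Vec m → Vec m) (h : Vec m → Vec m) (θ : ℤ → ℝ) (p : ℕ) (ω : ℝ)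
    (σ : ℤ → Vec m) (g : ℝ → Vec m) (Mf Mh Lf Lh N lam : ℝ)
    -- the standing setting
    (hf : Continuous (Function.uncurry f)) (hh : Continuous h)
    (hf_per : ∀ t x, f (t + ω) x = f t x)
    (hθ : RegularMoments θ p ω)
    (hg : ∀ k : ℤ, ∀ t ∈ Set.Ioc (θ (k * p)) (θ ((k + 1) * p)), g t = σ k)
    -- commutation and invertibility
    (hAB : Commute A B) (hdet : (1 + B).det ≠ 0)
    -- spectral condition on `A + (p/ω) log (I + B)`
    (hstab : StableLog A B (p / ω))
    -- boundedness
    (hMf : 0 < Mf) (hMh : 0 < Mh) (hf_bdd : ∀ t x, ‖f t x‖ ≤ Mf) (hh_bdd : ∀ x, ‖h x‖ ≤ Mh)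
    -- Lipschitz conditions
    (hLf : 0 < Lf) (hLh : 0 < Lh)
    (hf_lip : ∀ t x₁ x₂, ‖f t x₁ - f t x₂‖ ≤ Lf * ‖x₁ - x₂‖)
    (hh_lip : ∀ x₁ x₂, ‖h x₁ - h x₂‖ ≤ Lh * ‖x₁ - x₂‖)
    -- the constants of the exponential estimate of the matriciant
    (hN : 0 < N) (hlam : 0 < lam)
    (hU : ∀ t s : ℝ, s ≤ t → ‖matriciant A B θ t s‖ ≤ N * Real.exp (-lam * (t - s)))
    -- smallness conditions
    (hA5 : N * (Lf / lam + p * Lh / (1 - Real.exp (-lam * ω))) < 1)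
    (hA6 : N * Lf + p / ω * Real.log (1 + N * Lh) < lam)
    (hA7 : Lh * ‖(1 + B)⁻¹‖ < 1)
    (hσ : UnpredictableSeq σ) :
    ∃ φ : ℝ → Vec m,
      IsSolutionOn A B f g h θ Set.univ φ ∧
      AsymptoticallyStable A B f g h θ φ ∧
      UnpredictableFun θ φ ∧
      (∀ ζ : ℕ → ℕ, UnpredictableSeqWith σ ζ → UnpredictableFunWith θ φ (fun n => ω * ζ n)) ∧
      (∀ ψ : ℝ → Vec m, IsSolutionOn A B f g h θ Set.univ ψ → UnpredictableFun θ ψ → ψ = φ) := by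

  obtain ⟨C, hC, γ, hγ, hE⟩ := exists_exponential_estimate hθ hAB hN hLf hLh hU hA6
  obtain ⟨ζ₀, hζ₀⟩ := hσ
  obtain ⟨Mσ, hMσ⟩ := hζ₀.bounded
  have hg_bdd : ∀ t, ‖g t‖ ≤ Mσ := fun t => by
    obtain ⟨k, hk⟩ := hθ.exists_mem_Ioc t
    rw [eq_of_mem_Ioc_moments hθ hg hk]
    exact hMσ _
  obtain ⟨φ, hφ, R, hφR⟩ := exists_bounded_solution hθ hE hC hγ hLf.le hLh.le hf hf_bdd hh_bdd
    hg_bdd hf_lip hh_lip fun k => ⟨_, fun t ht => eq_of_mem_Ioc_moments hθ hg ht⟩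
  have hunp : ∀ ζ : ℕ → ℕ, UnpredictableSeqWith σ ζ →
      UnpredictableFunWith θ φ (fun n => ω * ζ n) := fun ζ hζ =>
    hζ.unpredictableFunWith hθ hE hC hγ hLf.le hf_per hf_bdd hg_bdd hf_lip hh_lip hg hφ hφR
  refine ⟨φ, hφ, hE.asymptoticallyStable hC hγ hf_lip hh_lip hφ, ⟨_, hunp ζ₀ hζ₀⟩, hunp,
    fun ψ hψ ⟨μ, hψμ⟩ => ?_⟩
  obtain ⟨S, hS⟩ := hψμ.bounded
  exact hE.eq_of_bounded hγ hf_lip hh_lip hψ hφ hS hφR
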